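/- All vectors carry the Euclidean norm and matrices the induced norm; $\bar x=[x^T,u^T]^T$. Let $f:\mathbb R^n\times\mathbb R^m\to\mathbb R^n$ be continuously differentiable. Suppose that the system $\dot x=f(x,u)$ is globally exponentially stabilizable (GES): there is a map $g:\mathbb R^n\times\mathbb R^m\to\mathbb R^m$, locally Lipschitz and differentiable at the origin (for instance $C^1$), such that the origin is globally exponentially stable for $\dot x=f(x,u),\ \dot u=g(x,u)$, i.e. there are $k,a>0$ such that from every initial point there is a solution on $[0,\infty)$ and all solutions satisfy $\|\bar x(t)\|\le k e^{-at}\|\bar x(0)\|$ for $t\ge 0$. Uncertain PWA models. Let $X\subset\mathbb R^n$, $U\subset\mathbb R^m$ be compact and contain the origin. An uncertain PWA model of $f$ on $X\times U$ consists of finitely many cells $\bar X_i=X_i\times U_i$, $i=0,\dots,l$, covering $X\times U$, with $X_i=X\cap P_i$, $U_i=U\cap Q_i$ for convex polyhedra $P_i,Q_i$ with non-empty interior, where the $P_i\times Q_i$ have pairwise disjoint interiors and contain the origin only for $i=0$; of matrices $A_i,B_i$ and vectors $C_i$ with $C_0=0$; and of error bounds $\varepsilon_{f0},\varepsilon_f,\varepsilon_g\ge0$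 such that on $\bar X_i$ $$f(x,u)=(A_i+\Delta A_i)x+(B_i+\Delta B_i)u+C_i+\Delta C_i,$$ where $\Delta A_i,\Delta B_i,\Delta C_i$ may depend on $(x,u)$, $\Delta C_0=0$, $\|[\Delta A_0,\Delta B_0]\|\le\varepsilon_{f0}$, and $\|[\Delta A_j,\Delta B_j]\|\le\varepsilon_f$, $\|\Delta C_j\|\le\varepsilon_g$ for $j\ge1$. Controller. Given such a model, matrices $S_x\in\mathbb R^{m\times n}$ and $S_u\in\mathbb R^{m\times m}$ nonsingular, $\gamma>0$, and gains $F_i,G_i,D_i$ with $D_0=0$, the piecewise integral sliding-mode parallel controller is, for $\bar x(t)\in\bar X_i$, $$\dot u=F_ix+G_iu+D_i-(\gamma+\beta_i+\sigma_i)\,S_u^{-1}\,\mathrm{sgn}(s),$$ with $\beta_0=0$, $\sigma_0=\varepsilon_{f0}\|S_x\|\|\bar x\|$, $\beta_j=\varepsilon_g\|S_x\|$, $\sigma_j=\varepsilon_f\|S_x\|\|\bar x\|$ for $j\ge1$, $\mathrm{sgn}$ taken componentwise, and $$s(t)=S_x[x(t)-x(0)]+S_u[u(t)-u(0)]-\int_0^t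 S_x(A_ix+B_iu+C_i)\,d\tau-\int_0^t S_u(F_ix+G_iu+D_i)\,d\tau,$$ $i$ being the index of the current cell. Solutions of the closed loop of $\dot x=f(x,u)$ with this controller are taken in the sense of Filippov: where $\mathrm{sgn}$ is discontinuous, or on common boundaries of cells, the values of the right-hand sides are replaced by measurable convex combinations of the neighbouring ones (the same cell weights being used in $s$). The sliding motion is the system $$\dot x=f(x,u),\qquad \dot u=F_ix+G_iu+D_i-S_u^{-1}S_x[\Delta A_ix+\Delta B_iu+\Delta C_i]\quad\text{for }\bar x\in\bar X_i,$$ with solutions in the same sense. Theorem. There are constants $M,\alpha>0$, depending only on $f$, such that for all compact $X\subset\mathbb R^n$ and $U\subset\mathbb R^m$ containing the origin, every $S_x$, every nonsingular $S_u$, every $\gamma>0$ and every $\varepsilon>0$, there exist an uncertain PWA model of $f$ on $X\times U$ with $\varepsilon_{f0},\varepsilon_f,\varepsilon_g\le\varepsilon$ and gains $F_i,G_i,D_i$ with $D_0=0$ for which the following holds. 1. Every closed-loop solution that stays in $X\times U$ on a time interval $[0,T]$, with any initial value (in particular with $u(0)=0$), satisfies $s(t)=0$ for all $t\in[0,T]$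 and is a solution of the sliding motion on $[0,T]$. 2. Every solution of the sliding motion that stays in $X\times U$ on $[0,T]$ satisfies $\|\bar x(t)\|\le M e^{-\alpha t}\|\bar x(0)\|$ for all $t\in[0,T]$. 3. For every $\bar x_0$ such that the closed ball of radius $M\|\bar x_0\|$ about the origin lies in $X\times U$, there is a closed-loop solution from $\bar x_0$ that stays in $X\times U$ for all $t\ge0$, and every closed-loop solution from $\bar x_0$ in $X\times U$ on an interval $[0,T]$ extends to such a solution on $[0,\infty)$. Thus the closed loop has a sliding motion from the initial time that is semi-globally exponentially stable: as $X\times U$ is arbitrary, any bounded set of initial states is covered. -/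

import Mathlib

open MeasureTheory Set

noncomputable section

namespace ISMPC

/-- Column vectors with the Euclidean norm. -/
abbrev Vec (n : ℕ) : Type := EuclideanSpace ℝ (Fin n)

/-- The extended vectors `x̄ = [xᵀ, uᵀ]ᵀ` with the Euclidean norm of `ℝ^(n+m)`. Matrices are
continuous linear maps; their operator norm is the induced norm. -/
abbrev XVec (n m : ℕ) : Type := EuclideanSpace ℝ (Fin n ⊕ Fin m)

/-- The state `x` of `x̄ = [xᵀ, uᵀ]ᵀ`. -/
def st {n m : ℕ} (z : XVec n m) : Vec n := WithLp.toLp 2 fun i => z (Sum.inl i)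

/-- The input `u` of `x̄ = [xᵀ, uᵀ]ᵀ`. -/
def inp {n m : ℕ} (z : XVec n m) : Vec m := WithLp.toLp 2 fun j => z (Sum.inr j)

/-- The extended vector `[xᵀ, uᵀ]ᵀ`. -/
def joinVec {n m : ℕ} (x : Vec n) (u : Vec m) : XVec n m := WithLp.toLp 2 (Sum.elim x u)

variable {n m l : ℕ}

/-! ### Global exponential stabilizability -/

/-- `z` solves `ż = F z` on `[0, ∞)`. -/
def IsSolution (F : XVec n m → XVec n m) (z : ℝ → XVec n m) : Prop :=
  ∀ t, 0 ≤ t → HasDerivWithinAt z (F (z t)) (Ici 0) t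

/-- The origin is globally exponentially stable for `ż = F z`: from every initial point there is a
solution on `[0, ∞)`, and all solutions obey one exponential estimate. -/
def IsGloballyExpStable (F : XVec n m → XVec n m) : Prop :=
  (∀ z₀, ∃ z, z 0 = z₀ ∧ IsSolution F z) ∧
  ∃ k > 0, ∃ a > 0, ∀ z, IsSolution F z →
    ∀ t, 0 ≤ t → ‖z t‖ ≤ k * Real.exp (-a * t) * ‖z 0‖

/-- The vector field of `ẋ = f(x,u)`, `u̇ = g(x,u)`. -/
def closedLoopField (f : XVec n m → Vec n) (g : XVec n m → Vec m) (z : XVec n m) : XVec n m :=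
  joinVec (f z) (g z)

/-- The plant `ẋ = f(x,u)` is globally exponentially stabilizable by a dynamic law `u̇ = g(x,u)`;
`g` is regular enough for the closed loop to be well posed and to have a linearization at the
origin (every `C¹` law qualifies). -/
def IsGES (f : XVec n m → Vec n) : Prop :=
  ∃ g : XVec n m → Vec m, LocallyLipschitz g ∧ DifferentiableAt ℝ g 0 ∧
    IsGloballyExpStable (closedLoopField f g)

/-! ### Uncertain piecewise affine models -/

/-- A convex polyhedron: a finite intersection of closed half-spaces. -/
def IsPolyhedron (P : Set (Vec n)) : Prop :=
  ∃ (k : ℕ) (a : Fin k → Vec n) (b : Fin k → ℝ), P = {x | ∀ j, inner ℝ (a j) x ≤ b j}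

/-- The rectangle `X × U` as a subset of the extended space. -/
def rect (X : Set (Vec n)) (U : Set (Vec m)) : Set (XVec n m) :=
  {z | st z ∈ X ∧ inp z ∈ U}

/-- An uncertain piecewise affine model of `f` on `X × U`. The cells are `X_i × U_i` with
`X_i = X ∩ P_i`, `U_i = U ∩ Q_i` for full-dimensional polyhedra `P_i`, `Q_i`; they cover `X × U`,
have non-overlapping interiors, and the origin lies in the cell `0` only. On the cell `i`,
`f(x,u) = (A_i + ΔA_i) x + (B_i + ΔB_i) u + C_i + ΔC_i`, with `[ΔA_i, ΔB_i]` and `ΔC_i` depending on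
the point, `‖[ΔA_0, ΔB_0]‖ ≤ εf0`, `C_0 = ΔC_0 = 0`, and `‖[ΔA_j, ΔB_j]‖ ≤ εf`, `‖ΔC_j‖ ≤ εg` for
`j ≠ 0`. -/
structure PWAModel (f : XVec n m → Vec n) (X : Set (Vec n)) (U : Set (Vec m)) (l : ℕ) where
  P : Fin (l + 1) → Set (Vec n)
  Q : Fin (l + 1) → Set (Vec m)
  polyhedron_P : ∀ i, IsPolyhedron (P i) ∧ (interior (P i)).Nonempty
  polyhedron_Q : ∀ i, IsPolyhedron (Q i) ∧ (interior (Q i)).Nonempty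
  cover : rect X U ⊆ ⋃ i, rect (P i) (Q i)
  adjacent : ∀ i j, i ≠ j → Disjoint (interior (rect (P i) (Q i))) (interior (rect (P j) (Q j)))
  origin : ∀ i, (0 : XVec n m) ∈ rect (P i) (Q i) ↔ i = 0
  A : Fin (l + 1) → Vec n →L[ℝ] Vec n
  B : Fin (l + 1) → Vec m →L[ℝ] Vec n
  C : Fin (l + 1) → Vec n
  C_zero : C 0 = 0
  εf0 : ℝ
  εf : ℝ
  εg : ℝ
  approx_zero : ∀ z ∈ rect (X ∩ P 0) (U ∩ Q 0), ∃ Δ : XVec n m →L[ℝ] Vec n, ‖Δ‖ ≤ εf0 ∧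
    f z = A 0 (st z) + B 0 (inp z) + Δ z
  approx : ∀ j, j ≠ 0 → ∀ z ∈ rect (X ∩ P j) (U ∩ Q j),
    ∃ (Δ : XVec n m →L[ℝ] Vec n) (δ : Vec n), ‖Δ‖ ≤ εf ∧ ‖δ‖ ≤ εg ∧
      f z = A j (st z) + B j (inp z) + Δ z + (C j + δ)
  εf0_nonneg : 0 ≤ εf0
  εf_nonneg : 0 ≤ εf
  εg_nonneg : 0 ≤ εg

namespace PWAModel

variable {f : XVec n m → Vec n} {X : Set (Vec n)} {U : Set (Vec m)}

/-- The cell `X_i × U_i`. -/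
def cell (p : PWAModel f X U l) (i : Fin (l + 1)) : Set (XVec n m) :=
  rect (X ∩ p.P i) (U ∩ p.Q i)

/-- The nominal affine model `A_i x + B_i u + C_i`. -/
def nominal (p : PWAModel f X U l) (i : Fin (l + 1)) (z : XVec n m) : Vec n :=
  p.A i (st z) + p.B i (inp z) + p.C i

end PWAModel

/-! ### The piecewise integral sliding-mode parallel controller -/

/-- The gains `F_i`, `G_i`, `D_i` of the controller, with `D_0 = 0`. -/
structure Gains (n m l : ℕ) where
  F : Fin (l + 1) → Vec n →L[ℝ] Vec m
  G : Fin (l + 1) → Vec m →L[ℝ] Vec m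
  D : Fin (l + 1) → Vec m
  D_zero : D 0 = 0

/-- The nominal law `F_i x + G_i u + D_i`. -/
def Gains.law (c : Gains n m l) (i : Fin (l + 1)) (z : XVec n m) : Vec m :=
  c.F i (st z) + c.G i (inp z) + c.D i

/-- The switching gain `γ + β_i + σ_i`, where `β_0 = 0`, `σ_0 = εf0 ‖S_x‖ ‖x̄‖` and
`β_j = εg ‖S_x‖`, `σ_j = εf ‖S_x‖ ‖x̄‖` for `j ≠ 0`. -/
def switchGain {f : XVec n m → Vec n} {X : Set (Vec n)} {U : Set (Vec m)} (p : PWAModel f X U l)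
    (Sx : Vec n →L[ℝ] Vec m) (γ : ℝ) (i : Fin (l + 1)) (z : XVec n m) : ℝ :=
  if i = 0 then γ + p.εf0 * ‖Sx‖ * ‖z‖
  else γ + p.εg * ‖Sx‖ + p.εf * ‖Sx‖ * ‖z‖

/-- Convexified componentwise sign: `v ∈ sgnSet s` iff `v k = sgn (s k)` where `s k ≠ 0` and
`v k ∈ [-1, 1]` where `s k = 0`. -/
def sgnSet (s : Vec m) : Set (Vec m) :=
  {v | ∀ k, (0 < s k → v k = 1) ∧ (s k < 0 → v k = -1) ∧ |v k| ≤ 1}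

/-- `w` is a measurable choice, for almost every `t ∈ [0, T]`, of convex weights on the cells that
contain `z t` (a single weight `1` when `z t` lies in one cell only). -/
structure IsCellWeight {f : XVec n m → Vec n} {X : Set (Vec n)} {U : Set (Vec m)}
    (p : PWAModel f X U l) (T : ℝ) (z : ℝ → XVec n m) (w : ℝ → Fin (l + 1) → ℝ) : Prop where
  measurable : ∀ i, Measurable fun t => w t i
  nonneg : ∀ᵐ t ∂volume.restrict (Icc 0 T), ∀ i, 0 ≤ w t i
  sum_eq_one : ∀ᵐ t ∂volume.restrict (Icc 0 T), ∑ i, w t i = 1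
  support : ∀ᵐ t ∂volume.restrict (Icc 0 T), ∀ i, w t i ≠ 0 → z t ∈ p.cell i

/-- The integral sliding variable
`s(t) = S_x [x(t) - x(0)] + S_u [u(t) - u(0)] - ∫₀ᵗ S_x (A_i x + B_i u + C_i)
  - ∫₀ᵗ S_u (F_i x + G_i u + D_i)`,
`i` being the current cell (on common boundaries of cells: averaged with the weights `w`). -/
def slidingVar {f : XVec n m → Vec n} {X : Set (Vec n)} {U : Set (Vec m)} (p : PWAModel f X U l)
    (c : Gains n m l) (Sx : Vec n →L[ℝ] Vec m) (Su : Vec m ≃L[ℝ] Vec m)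
    (z : ℝ → XVec n m) (w : ℝ → Fin (l + 1) → ℝ) (t : ℝ) : Vec m :=
  Sx (st (z t) - st (z 0)) + Su (inp (z t) - inp (z 0))
    - (∫ τ in (0 : ℝ)..t, ∑ i, w τ i • Sx (p.nominal i (z τ)))
    - ∫ τ in (0 : ℝ)..t, ∑ i, w τ i • Su (c.law i (z τ))

/-- A Filippov solution on `[0, T]`, inside `X × U`, of the plant `ẋ = f(x,u)` under the controller
`u̇ = F_i x + G_i u + D_i - (γ + β_i + σ_i) S_u⁻¹ sgn (s)` for `x̄ ∈ X_i × U_i`. The right-hand side is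
discontinuous across `s k = 0` and across the boundaries of the cells; there it is replaced by its
convex hull, which is what the selections `v` and `w` express. -/
structure IsClosedLoopSolution {f : XVec n m → Vec n} {X : Set (Vec n)} {U : Set (Vec m)}
    (p : PWAModel f X U l) (c : Gains n m l) (Sx : Vec n →L[ℝ] Vec m) (Su : Vec m ≃L[ℝ] Vec m)
    (γ T : ℝ) (z : ℝ → XVec n m) (w : ℝ → Fin (l + 1) → ℝ) (v : ℝ → Fin (l + 1) → Vec m) :
    Prop where
  continuousOn : ContinuousOn z (Icc 0 T)
  mem : ∀ t ∈ Icc 0 T, z t ∈ rect X U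
  weight : IsCellWeight p T z w
  measurable : ∀ i, Measurable fun t => v t i
  sgn : ∀ᵐ t ∂volume.restrict (Icc 0 T), ∀ i, v t i ∈ sgnSet (slidingVar p c Sx Su z w t)
  plant : ∀ t ∈ Icc 0 T, st (z t) = st (z 0) + ∫ τ in (0 : ℝ)..t, f (z τ)
  control : ∀ t ∈ Icc 0 T, inp (z t) = inp (z 0) + ∫ τ in (0 : ℝ)..t,
    ∑ i, w τ i • (c.law i (z τ) - switchGain p Sx γ i (z τ) • Su.symm (v τ i))

/-- A (Filippov) solution on `[0, T]`, inside `X × U`, of the sliding motion: the plant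
`ẋ = f(x,u)` with the equivalent control
`u̇ = F_i x + G_i u + D_i - S_u⁻¹ S_x [ΔA_i x + ΔB_i u + ΔC_i]` for `x̄ ∈ X_i × U_i`, in which
`ΔA_i x + ΔB_i u + ΔC_i = f(x,u) - (A_i x + B_i u + C_i)`. -/
structure IsSlidingMotion {f : XVec n m → Vec n} {X : Set (Vec n)} {U : Set (Vec m)}
    (p : PWAModel f X U l) (c : Gains n m l) (Sx : Vec n →L[ℝ] Vec m) (Su : Vec m ≃L[ℝ] Vec m)
    (T : ℝ) (z : ℝ → XVec n m) (w : ℝ → Fin (l + 1) → ℝ) : Prop where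
  continuousOn : ContinuousOn z (Icc 0 T)
  mem : ∀ t ∈ Icc 0 T, z t ∈ rect X U
  weight : IsCellWeight p T z w
  plant : ∀ t ∈ Icc 0 T, st (z t) = st (z 0) + ∫ τ in (0 : ℝ)..t, f (z τ)
  control : ∀ t ∈ Icc 0 T, inp (z t) = inp (z 0) + ∫ τ in (0 : ℝ)..t,
    ∑ i, w τ i • (c.law i (z τ) - Su.symm (Sx (f (z τ) - p.nominal i (z τ))))

end ISMPC

end

/-! The sliding variable starts at zero and its derivative is a convex combination of terms
`mismatch - switchGain • v`. The error bounds of the model make the switching gain exceed the norm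
of the mismatch (`norm_mismatch_add_le`), so each component is pushed back to zero wherever it is
non-zero. Hence `s = 0` from the initial time on, and integrating this identity replaces the
switching term by the equivalent control.

In the sliding motion the plant equation is exact; only the input equation differs from the
stabilizing law `g`. `exists_model` makes this difference at most `η * ‖x‖` on every cell. Near the
origin one linearizes `f` and `g`, with error `o(‖x‖)`; outside a small cube one uses constants on a
fine grid, where a small absolute error is also a small relative one because `‖x‖` is bounded below.
A relative perturbation preserves exponential decay: by Grönwall a sliding motion follows the exact
solution from the same point over a time `T₀` up to a quarter of the initial norm, while the exact
solution itself shrinks to a quarter. The norm is therefore halved every `T₀`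
(`IsPerturbedSolution.norm_le_exp`). `T₀` depends only on the constants of the stabilized system,
and the region enters only through the size of `η`; this is why `M` and `α` are uniform.

Existence rests on a Filippov theorem for finitely many continuous fields on closed sets
(`exists_filippov_solution`), proved by Euler polygons whose occupation times yield the weights. The
fields are retracted to a ball to become bounded and globally defined, and the decay estimate shows
that the retraction is never felt (`IsSlidingMotion.exists_extension`). Finally
`exists_isClosedLoopSolution` recovers the sign selection as the quotient of mismatch and switching
gain. -/

noncomputable section

namespace ISMPC

/-! ### Existence of Filippov solutions -/

section Filippov

open Filter Topology

variable {E ι : Type*} [NormedAddCommGroup E] [NormedSpace ℝ E]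

/-- The explicit Euler polygon with step `h` for the field `H (j x) x`. -/
def eulerNode (H : ι → E → E) (j : E → ι) (z₀ : E) (h : ℝ) : ℕ → E
  | 0 => z₀
  | k + 1 => eulerNode H j z₀ h k + h • H (j (eulerNode H j z₀ h k)) (eulerNode H j z₀ h k)

open Classical in
/-- The time that the Euler polygon spends in mode `i` during its first `k` steps. -/
def eulerTime (H : ι → E → E) (j : E → ι) (z₀ : E) (h : ℝ) (i : ι) : ℕ → ℝ
  | 0 => 0
  | k + 1 => eulerTime H j z₀ h i k + if j (eulerNode H j z₀ h k) = i then h else 0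

variable {H : ι → E → E} {j : E → ι} {z₀ : E} {h : ℝ}

lemma eulerTime_sub_mem (hh : 0 ≤ h) (i : ι) {a b : ℕ} (hab : a ≤ b) :
    0 ≤ eulerTime H j z₀ h i b - eulerTime H j z₀ h i a ∧
      eulerTime H j z₀ h i b - eulerTime H j z₀ h i a ≤ h * (b - a) := by
  induction b, hab using Nat.le_induction with
  | base => simp
  | succ b hab ih =>
    simp only [eulerTime]
    push_cast
    split_ifs <;> constructor <;> nlinarith [ih.1, ih.2]

lemma sum_eulerTime [Fintype ι] (k : ℕ) : ∑ i, eulerTime H j z₀ h i k = h * k := by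
  induction k with
  | zero => simp [eulerTime]
  | succ k ih =>
    classical
    simp only [eulerTime, Finset.sum_add_distrib, ih, Finset.sum_ite_eq, Finset.mem_univ, if_true]
    push_cast
    ring

lemma eulerTime_eq_of_notMem {S : ι → Set E} (hj : ∀ x, x ∈ S (j x)) {i : ι} {a b : ℕ}
    (hab : a ≤ b) (hx : ∀ k, a ≤ k → k < b → eulerNode H j z₀ h k ∉ S i) :
    eulerTime H j z₀ h i b = eulerTime H j z₀ h i a := by
  induction b, hab using Nat.le_induction with
  | base => rfl
  | succ b hab ih =>
    have h1 : j (eulerNode H j z₀ h b) ≠ i := by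
      rintro rfl
      exact hx b hab b.lt_succ_self (hj _)
    simp only [eulerTime, if_neg h1, add_zero]
    exact ih fun k hk hkb => hx k hk (hkb.trans b.lt_succ_self)

lemma norm_eulerNode_sub_le {C : ℝ} (hh : 0 ≤ h) (hC : ∀ i x, ‖H i x‖ ≤ C) {a b : ℕ}
    (hab : a ≤ b) : ‖eulerNode H j z₀ h b - eulerNode H j z₀ h a‖ ≤ C * (h * (b - a)) := by
  induction b, hab using Nat.le_induction with
  | base => simp
  | succ b hab ih =>
    simp only [eulerNode]
    rw [add_sub_right_comm]
    refine (norm_add_le _ _).trans ?_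
    rw [norm_smul, Real.norm_of_nonneg hh]
    have := mul_le_mul_of_nonneg_left (hC (j (eulerNode H j z₀ h b)) (eulerNode H j z₀ h b)) hh
    push_cast
    linarith

/-- Freezing the fields at `y` makes the order of the visited modes irrelevant: only the occupation
times remain, and these survive the passage to the limit. -/
lemma norm_eulerNode_sub_sum_le [Fintype ι] {ε : ℝ} (hh : 0 ≤ h) {y : E} {a b : ℕ} (hab : a ≤ b)
    (hx : ∀ k, a ≤ k → k < b → ∀ i, ‖H i (eulerNode H j z₀ h k) - H i y‖ ≤ ε) :
    ‖eulerNode H j z₀ h b - eulerNode H j z₀ h a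
      - ∑ i, (eulerTime H j z₀ h i b - eulerTime H j z₀ h i a) • H i y‖ ≤ ε * (h * (b - a)) := by
  induction b, hab using Nat.le_induction with
  | base => simp
  | succ b hab ih =>
    have h1 := ih fun k hk hkb => hx k hk (hkb.trans b.lt_succ_self)
    have h2 := hx b hab b.lt_succ_self (j (eulerNode H j z₀ h b))
    have h3 : ∑ i, (eulerTime H j z₀ h i (b + 1) - eulerTime H j z₀ h i a) • H i y
        = ∑ i, (eulerTime H j z₀ h i b - eulerTime H j z₀ h i a) • H i y
          + h • H (j (eulerNode H j z₀ h b)) y := by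
      classical
      simp only [eulerTime, add_sub_right_comm, add_smul, Finset.sum_add_distrib, ite_smul,
        zero_smul, Finset.sum_ite_eq, Finset.mem_univ, if_true]
    rw [h3]
    simp only [eulerNode]
    have h4 := mul_le_mul_of_nonneg_left h2 hh
    rw [← Real.norm_of_nonneg hh, ← norm_smul, Real.norm_of_nonneg hh, smul_sub] at h4
    calc _ = ‖(eulerNode H j z₀ h b - eulerNode H j z₀ h a
              - ∑ i, (eulerTime H j z₀ h i b - eulerTime H j z₀ h i a) • H i y)
            + (h • H (j (eulerNode H j z₀ h b)) (eulerNode H j z₀ h b)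
              - h • H (j (eulerNode H j z₀ h b)) y)‖ := by congr 1; abel
      _ ≤ _ := norm_add_le _ _
      _ ≤ _ := by push_cast; linarith

/-! ### Limits of Euler polygons and of their occupation times. -/

lemma exists_tendsto_of_bounded {F : Type*} [NormedAddCommGroup F] [ProperSpace F]
    (l : Ultrafilter ℕ) {u : ℕ → F} {R : ℝ} (hu : ∀ N, ‖u N‖ ≤ R) :
    ∃ x, Tendsto u l (𝓝 x) := by
  obtain ⟨x, -, hx⟩ := (isCompact_closedBall (0 : F) R).ultrafilter_le_nhds (l.map u) (by
    simp only [le_principal_iff, Ultrafilter.mem_coe, Ultrafilter.mem_map]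
    exact Filter.univ_mem' fun N => by simpa using hu N)
  exact ⟨x, hx⟩

/-- The Euler node reached at time `t`, when starting at time `T` with step `1 / (N + 1)`. -/
def eulerIndex (T : ℝ) (N : ℕ) (t : ℝ) : ℕ := ⌊(t - T) * (N + 1)⌋₊

lemma eulerIndex_mono (T : ℝ) (N : ℕ) : Monotone (eulerIndex T N) := fun s t hst =>
  Nat.floor_mono (by gcongr)

/-- Rounding costs at most one step. Before `T` the truncated floor gives index `0`, so the scheme
is constant there and the estimates hold on the whole line. -/
lemma eulerIndex_sub_le (T : ℝ) (N : ℕ) {s t : ℝ} (hst : s ≤ t) :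
    (1 / ((N : ℝ) + 1)) * (eulerIndex T N t - eulerIndex T N s) ≤ t - s + 1 / ((N : ℝ) + 1) := by
  have hN : (0 : ℝ) < N + 1 := by positivity
  have h1 : (eulerIndex T N t : ℝ) - eulerIndex T N s ≤ (t - s) * (N + 1) + 1 := by
    have h2 : (t - T) * (N + 1) < eulerIndex T N s + 1 + (t - s) * (N + 1) := by
      have := Nat.lt_floor_add_one ((s - T) * ((N : ℝ) + 1))
      simp only [eulerIndex]
      nlinarith
    rcases le_total 0 ((t - T) * ((N : ℝ) + 1)) with h0 | h0
    · have := Nat.floor_le h0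
      simp only [eulerIndex] at h2 ⊢
      linarith
    · have h3 : eulerIndex T N t = 0 := Nat.floor_of_nonpos h0
      have : 0 ≤ (t - s) * ((N : ℝ) + 1) := mul_nonneg (by linarith) hN.le
      have : (0 : ℝ) ≤ eulerIndex T N s := by positivity
      rw [h3]
      push_cast
      linarith
  calc _ ≤ (1 / ((N : ℝ) + 1)) * ((t - s) * (N + 1) + 1) := by gcongr
    _ = _ := by field_simp

lemma tendsto_eulerIndex {T t : ℝ} (ht : T ≤ t) :
    Tendsto (fun N : ℕ => (1 / ((N : ℝ) + 1)) * eulerIndex T N t) atTop (𝓝 (t - T)) := by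
  have h0 := tendsto_one_div_add_atTop_nhds_zero_nat (𝕜 := ℝ)
  have h1 : Tendsto (fun N : ℕ => t - T - 1 / ((N : ℝ) + 1)) atTop (𝓝 (t - T)) := by
    simpa using h0.const_sub (t - T)
  refine tendsto_of_tendsto_of_tendsto_of_le_of_le h1 tendsto_const_nhds (fun N => ?_) fun N => ?_
  · have hN : (0 : ℝ) < N + 1 := by positivity
    have := Nat.lt_floor_add_one ((t - T) * ((N : ℝ) + 1))
    simp only [eulerIndex]
    calc _ = (1 / ((N : ℝ) + 1)) * ((t - T) * (N + 1) - 1) := by field_simp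
      _ ≤ _ := by gcongr; linarith
  · have hN : (0 : ℝ) < N + 1 := by positivity
    have := Nat.floor_le (a := (t - T) * ((N : ℝ) + 1)) (mul_nonneg (by linarith) hN.le)
    simp only [eulerIndex]
    calc _ ≤ (1 / ((N : ℝ) + 1)) * ((t - T) * (N + 1)) := by gcongr
      _ = _ := by field_simp

variable {C T : ℝ} {l : Ultrafilter ℕ}

/-- `z` and `W` are the limits, along `l`, of the Euler polygons started at time `T` and of the
times that they spend in the modes. -/
structure IsEulerLimit (H : ι → E → E) (j : E → ι) (z₀ : E) (T : ℝ) (l : Ultrafilter ℕ)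
    (z : ℝ → E) (W : ι → ℝ → ℝ) : Prop where
  node : ∀ t, Tendsto (fun N : ℕ => eulerNode H j z₀ (1 / ((N : ℝ) + 1)) (eulerIndex T N t)) l
    (𝓝 (z t))
  time : ∀ i t, Tendsto (fun N : ℕ => eulerTime H j z₀ (1 / ((N : ℝ) + 1)) i (eulerIndex T N t)) l
    (𝓝 (W i t))

lemma eulerIndex_self (T : ℝ) (N : ℕ) : eulerIndex T N T = 0 := by simp [eulerIndex]

lemma mul_eulerIndex_le (T : ℝ) (N : ℕ) (t : ℝ) :
    (1 / ((N : ℝ) + 1)) * eulerIndex T N t ≤ |t - T| + 1 := by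
  have h1 : (1 : ℝ) / ((N : ℝ) + 1) ≤ 1 := by
    rw [div_le_one (by positivity)]
    linarith [(Nat.cast_nonneg N : (0 : ℝ) ≤ N)]
  rcases le_total T t with h | h
  · have := eulerIndex_sub_le T N h
    rw [eulerIndex_self] at this
    have := le_abs_self (t - T)
    push_cast at *
    linarith
  · have h2 : eulerIndex T N t = 0 := by
      have := eulerIndex_mono T N h
      rw [eulerIndex_self] at this
      omega
    rw [h2]
    push_cast
    linarith [abs_nonneg (t - T)]

/-- For fixed `t` everything is bounded uniformly in `N`, so an ultrafilter gives convergence at all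
times simultaneously, with no extraction of subsequences. -/
lemma exists_isEulerLimit [ProperSpace E] (hC : ∀ i x, ‖H i x‖ ≤ C) (j : E → ι) (z₀ : E) (T : ℝ)
    (l : Ultrafilter ℕ) : ∃ z W, IsEulerLimit H j z₀ T l z W := by
  have hC0 : 0 ≤ C := (norm_nonneg _).trans (hC (j z₀) z₀)
  have h1 : ∀ t, ∃ x, Tendsto
      (fun N : ℕ => eulerNode H j z₀ (1 / ((N : ℝ) + 1)) (eulerIndex T N t)) l (𝓝 x) := by
    intro t
    refine exists_tendsto_of_bounded l (R := C * (|t - T| + 1) + ‖z₀‖) fun N => ?_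
    have h2 := norm_eulerNode_sub_le (j := j) (z₀ := z₀)
      (by positivity : (0 : ℝ) ≤ 1 / ((N : ℝ) + 1)) hC (Nat.zero_le (eulerIndex T N t))
    have h3 := mul_le_mul_of_nonneg_left (mul_eulerIndex_le T N t) hC0
    have h4 := norm_le_norm_add_norm_sub' (eulerNode H j z₀ (1 / ((N : ℝ) + 1)) (eulerIndex T N t))
      (eulerNode H j z₀ (1 / ((N : ℝ) + 1)) 0)
    simp only [eulerNode, Nat.cast_zero, sub_zero] at h2 h4
    linarith
  have h2 : ∀ i t, ∃ x, Tendsto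
      (fun N : ℕ => eulerTime H j z₀ (1 / ((N : ℝ) + 1)) i (eulerIndex T N t)) l (𝓝 x) := by
    intro i t
    refine exists_tendsto_of_bounded l (R := |t - T| + 1) fun N => ?_
    have h2 := eulerTime_sub_mem (H := H) (j := j) (z₀ := z₀)
      (by positivity : (0 : ℝ) ≤ 1 / ((N : ℝ) + 1)) i (Nat.zero_le (eulerIndex T N t))
    have h3 := mul_eulerIndex_le T N t
    simp only [eulerTime, Nat.cast_zero, sub_zero] at h2
    rw [Real.norm_of_nonneg h2.1]
    linarith
  choose z hz using h1
  choose W hW using h2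
  exact ⟨z, W, hz, hW⟩

namespace IsEulerLimit

variable {z : ℝ → E} {W : ι → ℝ → ℝ}

lemma initial (h : IsEulerLimit H j z₀ T l z W) : z T = z₀ := by
  have h1 := h.node T
  simp only [eulerIndex_self, eulerNode] at h1
  exact tendsto_nhds_unique h1 tendsto_const_nhds

lemma tendsto_step (hl : (l : Filter ℕ) ≤ atTop) :
    Tendsto (fun N : ℕ => 1 / ((N : ℝ) + 1)) l (𝓝 0) :=
  (tendsto_one_div_add_atTop_nhds_zero_nat (𝕜 := ℝ)).mono_left hl

lemma time_sub_mem (h : IsEulerLimit H j z₀ T l z W) (hl : (l : Filter ℕ) ≤ atTop) (i : ι) {s t : ℝ}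
    (hst : s ≤ t) : 0 ≤ W i t - W i s ∧ W i t - W i s ≤ t - s := by
  have h1 := (h.time i t).sub (h.time i s)
  have h2 := fun N : ℕ => eulerTime_sub_mem (H := H) (j := j) (z₀ := z₀)
    (by positivity : (0 : ℝ) ≤ 1 / ((N : ℝ) + 1)) i (eulerIndex_mono T N hst)
  refine ⟨ge_of_tendsto' h1 fun N => (h2 N).1, ?_⟩
  have h3 : Tendsto (fun N : ℕ => t - s + 1 / ((N : ℝ) + 1)) l (𝓝 (t - s)) := by
    simpa using (tendsto_step hl).const_add (t - s)
  exact le_of_tendsto_of_tendsto' h1 h3 fun N => (h2 N).2.trans (eulerIndex_sub_le T N hst)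

lemma norm_node_sub_le (h : IsEulerLimit H j z₀ T l z W) (hl : (l : Filter ℕ) ≤ atTop)
    (hC : ∀ i x, ‖H i x‖ ≤ C) {s t : ℝ} (hst : s ≤ t) : ‖z t - z s‖ ≤ C * (t - s) := by
  have hC0 : 0 ≤ C := (norm_nonneg _).trans (hC (j z₀) z₀)
  have h1 := ((h.node t).sub (h.node s)).norm
  have h3 : Tendsto (fun N : ℕ => C * (t - s + 1 / ((N : ℝ) + 1))) l (𝓝 (C * (t - s))) := by
    simpa using ((tendsto_step hl).const_add (t - s)).const_mul C
  exact le_of_tendsto_of_tendsto' h1 h3 fun N =>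
    (norm_eulerNode_sub_le (by positivity) hC (eulerIndex_mono T N hst)).trans
      (mul_le_mul_of_nonneg_left (eulerIndex_sub_le T N hst) hC0)

lemma lipschitz_time (h : IsEulerLimit H j z₀ T l z W) (hl : (l : Filter ℕ) ≤ atTop) (i : ι) :
    LipschitzWith 1 (W i) := by
  refine LipschitzWith.of_dist_le_mul fun s t => ?_
  rw [NNReal.coe_one, one_mul]
  rcases le_total s t with hst | hst
  · have := h.time_sub_mem hl i hst
    rw [dist_comm, dist_comm s, Real.dist_eq, Real.dist_eq, abs_of_nonneg this.1,
      abs_of_nonneg (by linarith)]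
    exact this.2
  · have := h.time_sub_mem hl i hst
    rw [Real.dist_eq, Real.dist_eq, abs_of_nonneg this.1, abs_of_nonneg (by linarith)]
    exact this.2

lemma lipschitz_node (h : IsEulerLimit H j z₀ T l z W) (hl : (l : Filter ℕ) ≤ atTop)
    (hC : ∀ i x, ‖H i x‖ ≤ C) : LipschitzWith C.toNNReal z := by
  have hC0 : 0 ≤ C := (norm_nonneg _).trans (hC (j z₀) z₀)
  refine LipschitzWith.of_dist_le_mul fun s t => ?_
  rw [Real.coe_toNNReal _ hC0]
  rcases le_total s t with hst | hst
  · rw [dist_comm, dist_comm s, dist_eq_norm, Real.dist_eq, abs_of_nonneg (by linarith)]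
    exact h.norm_node_sub_le hl hC hst
  · rw [dist_eq_norm, Real.dist_eq, abs_of_nonneg (by linarith)]
    exact h.norm_node_sub_le hl hC hst

lemma sum_time [Fintype ι] (h : IsEulerLimit H j z₀ T l z W) (hl : (l : Filter ℕ) ≤ atTop) {t : ℝ}
    (ht : T ≤ t) : ∑ i, W i t = t - T := by
  have h1 := tendsto_finsetSum Finset.univ fun i _ => h.time i t
  simp only [sum_eulerTime] at h1
  exact tendsto_nhds_unique h1 ((tendsto_eulerIndex ht).mono_left hl)

/-- On a small ball around `z t` every field is nearly constant and, the sets `S i` being closed, no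
mode is active whose set misses `z t`. The speed bound keeps the polygons in that ball at times near
`t`, for `l`-almost all `N`. -/
lemma local_estimate [Fintype ι] (h : IsEulerLimit H j z₀ T l z W) (hl : (l : Filter ℕ) ≤ atTop)
    (hC : ∀ i x, ‖H i x‖ ≤ C) (hH : ∀ i, Continuous (H i)) {S : ι → Set E}
    (hS : ∀ i, IsClosed (S i)) (hj : ∀ x, x ∈ S (j x)) (t : ℝ) {ε : ℝ} (hε : 0 < ε) :
    ∃ δ > 0, ∀ s₁ s₂, |s₁ - t| < δ → |s₂ - t| < δ → s₁ ≤ s₂ →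
      ‖z s₂ - z s₁ - ∑ i, (W i s₂ - W i s₁) • H i (z t)‖ ≤ ε * (s₂ - s₁) ∧
      ∀ i, z t ∉ S i → W i s₂ = W i s₁ := by
  have hC0 : 0 ≤ C := (norm_nonneg _).trans (hC (j z₀) z₀)
  have h1 : ∀ᶠ x in 𝓝 (z t), ∀ i, ‖H i x - H i (z t)‖ ≤ ε ∧ (z t ∉ S i → x ∉ S i) := by
    refine eventually_all.2 fun i => Eventually.and ?_ ?_
    · have := (hH i).continuousAt.eventually (Metric.closedBall_mem_nhds (H i (z t)) hε)
      filter_upwards [this] with x hx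
      rwa [← dist_eq_norm]
    · by_cases hi : z t ∈ S i
      · exact Eventually.of_forall fun x hx => absurd hi hx
      · filter_upwards [(hS i).isOpen_compl.mem_nhds hi] with x hx _ using hx
  obtain ⟨r, hr, hball⟩ := Metric.eventually_nhds_iff.1 h1
  -- The window around `t` has length `2 * δ` and rounding adds less than `δ`, so a polygon travels
  -- at most `3 * C * δ`. Together with an error `r / 4` of the node at `t` this stays below `r`.
  -- The `1` in `C + 1` covers `C = 0`.
  refine ⟨r / (4 * (C + 1)), by positivity, fun s₁ s₂ hs₁ hs₂ hs => ?_⟩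
  set δ := r / (4 * (C + 1)) with hδ
  have hδ0 : 0 < δ := by positivity
  have hCδ : 3 * (C * δ) + r / 4 < r := by
    have : 4 * (C + 1) * δ = r := by rw [hδ]; field_simp
    nlinarith
  have h2 : ∀ᶠ N : ℕ in l, ∀ k, eulerIndex T N s₁ ≤ k → k < eulerIndex T N s₂ →
      dist (eulerNode H j z₀ (1 / ((N : ℝ) + 1)) k) (z t) < r := by
    have h3 := (h.node t).eventually (Metric.ball_mem_nhds (z t) (by positivity : 0 < r / 4))
    have h4 := (tendsto_step hl).eventually (gt_mem_nhds hδ0)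
    filter_upwards [h3, h4] with N h3 h4 k hk1 hk2
    have hh : (0 : ℝ) ≤ 1 / ((N : ℝ) + 1) := by positivity
    have a1 := abs_lt.1 hs₁
    have a2 := abs_lt.1 hs₂
    have i1 : eulerIndex T N (t - δ) ≤ k := (eulerIndex_mono T N (by linarith)).trans hk1
    have i2 : k ≤ eulerIndex T N (t + δ) := hk2.le.trans (eulerIndex_mono T N (by linarith))
    have i3 : eulerIndex T N (t - δ) ≤ eulerIndex T N t := eulerIndex_mono T N (by linarith)
    have i4 : eulerIndex T N t ≤ eulerIndex T N (t + δ) := eulerIndex_mono T N (by linarith)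
    have h5 := eulerIndex_sub_le T N (show t - δ ≤ t + δ by linarith)
    have h6 : ‖eulerNode H j z₀ (1 / ((N : ℝ) + 1)) k
        - eulerNode H j z₀ (1 / ((N : ℝ) + 1)) (eulerIndex T N t)‖ ≤ C * (3 * δ) := by
      have i1' : (eulerIndex T N (t - δ) : ℝ) ≤ k := by exact_mod_cast i1
      have i2' : (k : ℝ) ≤ eulerIndex T N (t + δ) := by exact_mod_cast i2
      have i3' : (eulerIndex T N (t - δ) : ℝ) ≤ eulerIndex T N t := by exact_mod_cast i3
      have i4' : (eulerIndex T N t : ℝ) ≤ eulerIndex T N (t + δ) := by exact_mod_cast i4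
      rcases le_total k (eulerIndex T N t) with hk | hk
      · rw [norm_sub_rev]
        refine (norm_eulerNode_sub_le hh hC hk).trans (mul_le_mul_of_nonneg_left ?_ hC0)
        have := mul_le_mul_of_nonneg_left (show (eulerIndex T N t : ℝ) - k ≤
          eulerIndex T N (t + δ) - eulerIndex T N (t - δ) by linarith) hh
        linarith
      · refine (norm_eulerNode_sub_le hh hC hk).trans (mul_le_mul_of_nonneg_left ?_ hC0)
        have := mul_le_mul_of_nonneg_left (show (k : ℝ) - eulerIndex T N t ≤
          eulerIndex T N (t + δ) - eulerIndex T N (t - δ) by linarith) hh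
        linarith
    have h7 := dist_triangle (eulerNode H j z₀ (1 / ((N : ℝ) + 1)) k)
      (eulerNode H j z₀ (1 / ((N : ℝ) + 1)) (eulerIndex T N t)) (z t)
    rw [dist_eq_norm (eulerNode H j z₀ (1 / ((N : ℝ) + 1)) k)
      (eulerNode H j z₀ (1 / ((N : ℝ) + 1)) (eulerIndex T N t))] at h7
    linarith
  constructor
  · have h3 := (((h.node s₂).sub (h.node s₁)).sub (tendsto_finsetSum Finset.univ fun i _ =>
      ((h.time i s₂).sub (h.time i s₁)).smul_const (H i (z t)))).norm
    have h4 : Tendsto (fun N : ℕ => ε * (s₂ - s₁ + 1 / ((N : ℝ) + 1))) l (𝓝 (ε * (s₂ - s₁))) := by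
      simpa using ((tendsto_step hl).const_add (s₂ - s₁)).const_mul ε
    refine le_of_tendsto_of_tendsto h3 h4 ?_
    filter_upwards [h2] with N hN
    exact (norm_eulerNode_sub_sum_le (by positivity) (eulerIndex_mono T N hs)
      fun k hk1 hk2 i => (hball (hN k hk1 hk2) i).1).trans
      (mul_le_mul_of_nonneg_left (eulerIndex_sub_le T N hs) hε.le)
  · intro i hi
    refine tendsto_nhds_unique ((h.time i s₂).congr' ?_) (h.time i s₁)
    filter_upwards [h2] with N hN
    exact eulerTime_eq_of_notMem hj (eulerIndex_mono T N hs)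
      fun k hk1 hk2 => (hball (hN k hk1 hk2) i).2 hi

lemma hasDerivAt_node [Fintype ι] (h : IsEulerLimit H j z₀ T l z W) (hl : (l : Filter ℕ) ≤ atTop)
    (hC : ∀ i x, ‖H i x‖ ≤ C) (hH : ∀ i, Continuous (H i)) {t : ℝ}
    (hW : ∀ i, DifferentiableAt ℝ (W i) t) :
    HasDerivAt z (∑ i, deriv (W i) t • H i (z t)) t := by
  have h1 : HasDerivAt (fun s => z s - ∑ i, W i s • H i (z t)) 0 t := by
    rw [hasDerivAt_iff_isLittleO, Asymptotics.isLittleO_iff]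
    intro ε hε
    obtain ⟨δ, hδ, hest⟩ := h.local_estimate hl hC hH (S := fun _ => univ)
      (fun _ => isClosed_univ) (fun _ => mem_univ _) t hε
    filter_upwards [Metric.ball_mem_nhds t hδ] with s hs
    rw [Metric.mem_ball, Real.dist_eq] at hs
    have h2 : z s - ∑ i, W i s • H i (z t) - (z t - ∑ i, W i t • H i (z t)) - (s - t) • (0 : E)
        = z s - z t - ∑ i, (W i s - W i t) • H i (z t) := by
      simp only [sub_smul, Finset.sum_sub_distrib, smul_zero]
      abel
    rw [h2, Real.norm_eq_abs]
    rcases le_total t s with hst | hst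
    · rw [abs_of_nonneg (by linarith)]
      exact (hest t s (by simpa) hs hst).1
    · rw [abs_of_nonpos (by linarith), neg_sub]
      have h3 := (hest s t hs (by simpa) hst).1
      have h4 : z s - z t - ∑ i, (W i s - W i t) • H i (z t)
          = -(z t - z s - ∑ i, (W i t - W i s) • H i (z t)) := by
        simp only [sub_smul, Finset.sum_sub_distrib]
        abel
      rwa [h4, norm_neg]
  have h2 : HasDerivAt (fun s => ∑ i, W i s • H i (z t)) (∑ i, deriv (W i) t • H i (z t)) t :=
    HasDerivAt.fun_sum fun i _ => (hW i).hasDerivAt.smul_const (H i (z t))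
  have h3 := h1.add h2
  rw [zero_add] at h3
  refine h3.congr_of_eventuallyEq (Eventually.of_forall fun s => ?_)
  exact (sub_add_cancel _ _).symm

lemma deriv_time_eq_zero [Fintype ι] (h : IsEulerLimit H j z₀ T l z W)
    (hl : (l : Filter ℕ) ≤ atTop) (hC : ∀ i x, ‖H i x‖ ≤ C) (hH : ∀ i, Continuous (H i))
    {S : ι → Set E} (hS : ∀ i, IsClosed (S i)) (hj : ∀ x, x ∈ S (j x)) {t : ℝ} {i : ι}
    (hi : z t ∉ S i) : deriv (W i) t = 0 := by
  obtain ⟨δ, hδ, hest⟩ := h.local_estimate hl hC hH hS hj t one_pos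
  have h1 : W i =ᶠ[𝓝 t] fun _ => W i t := by
    filter_upwards [Metric.ball_mem_nhds t hδ] with s hs
    rw [Metric.mem_ball, Real.dist_eq] at hs
    rcases le_total t s with hst | hst
    · exact (hest t s (by simpa) hs hst).2 i hi
    · exact ((hest s t hs (by simpa) hst).2 i hi).symm
  rw [h1.deriv_eq, deriv_const]

end IsEulerLimit

/-- Existence of Filippov solutions for finitely many bounded continuous fields `H i`, active on
closed sets `S i` that cover the space. -/
theorem exists_filippov_solution [FiniteDimensional ℝ E] [Fintype ι] (hH : ∀ i, Continuous (H i))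
    (hC : ∀ i x, ‖H i x‖ ≤ C) {S : ι → Set E} (hS : ∀ i, IsClosed (S i))
    (hcover : ∀ x, ∃ i, x ∈ S i) (T : ℝ) (z₀ : E) :
    ∃ (z : ℝ → E) (w : ℝ → ι → ℝ), z T = z₀ ∧ Continuous z ∧ (∀ i, Measurable fun t => w t i) ∧
      (∀ᵐ t, T ≤ t → (∀ i, 0 ≤ w t i) ∧ ∑ i, w t i = 1 ∧ ∀ i, w t i ≠ 0 → z t ∈ S i) ∧
      ∀ t, T ≤ t → z t = z₀ + ∫ τ in T..t, ∑ i, w τ i • H i (z τ) := by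
  have : ProperSpace E := FiniteDimensional.proper ℝ E
  choose j hj using hcover
  have hC0 : 0 ≤ C := (norm_nonneg _).trans (hC (j z₀) z₀)
  have hl : (hyperfilter ℕ : Filter ℕ) ≤ atTop := Nat.hyperfilter_le_atTop
  obtain ⟨z, W, h⟩ := exists_isEulerLimit hC j z₀ T (hyperfilter ℕ)
  -- The weights are the derivatives of the occupation times, which are Lipschitz and hence
  -- differentiable almost everywhere.
  have hdiff : ∀ᵐ t, ∀ i, DifferentiableAt ℝ (W i) t :=
    ae_all_iff.2 fun i => (h.lipschitz_time hl i).ae_differentiableAt_real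
  have hz := h.lipschitz_node hl hC
  have hw1 : ∀ i t, ‖deriv (W i) t‖ ≤ 1 := fun i t => by
    simpa using norm_deriv_le_of_lipschitz (h.lipschitz_time hl i) (x₀ := t)
  have hmeas : ∀ i, Measurable fun t => deriv (W i) t := fun i => measurable_deriv _
  set φ : ℝ → E := fun τ => ∑ i, deriv (W i) τ • H i (z τ) with hφ
  have hφb : ∀ t, ‖φ t‖ ≤ Fintype.card ι * C := fun t => by
    refine (norm_sum_le _ _).trans ?_
    rw [← nsmul_eq_mul, ← Finset.card_univ, ← Finset.sum_const]
    refine Finset.sum_le_sum fun i _ => ?_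
    rw [norm_smul]
    nlinarith [hw1 i t, hC i (z t), norm_nonneg (H i (z t)), norm_nonneg (deriv (W i) t)]
  have hφm : StronglyMeasurable φ := by
    refine Finset.stronglyMeasurable_fun_sum _ fun i _ => ?_
    exact (hmeas i).stronglyMeasurable.smul ((hH i).comp hz.continuous).stronglyMeasurable
  have hφint : ∀ a b, IntervalIntegrable φ volume a b := fun a b =>
    intervalIntegrable_iff.2 (Measure.integrableOn_of_bounded (by simp)
      hφm.aestronglyMeasurable (ae_of_all _ hφb))
  refine ⟨z, fun t i => deriv (W i) t, h.initial, hz.continuous, hmeas, ?_, fun t ht => ?_⟩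
  -- The occupation times sum to `t - T` only from `T` on, so a two-sided derivative requires `t ≠
  -- T`.
  · have hne : ∀ᵐ t : ℝ, t ≠ T := by simp [ae_iff, measure_singleton]
    filter_upwards [hdiff, hne] with t hd ht hTt
    refine ⟨fun i => ?_, ?_, fun i hi => ?_⟩
    · exact Monotone.deriv_nonneg fun a b hab => by linarith [(h.time_sub_mem hl i hab).1]
    · have h1 : HasDerivAt (fun s => ∑ i, W i s) (∑ i, deriv (W i) t) t :=
        HasDerivAt.fun_sum fun i _ => (hd i).hasDerivAt
      have h2 : HasDerivAt (fun s => ∑ i, W i s) 1 t := by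
        refine ((hasDerivAt_id t).sub_const T).congr_of_eventuallyEq ?_
        filter_upwards [Ioi_mem_nhds (lt_of_le_of_ne hTt (Ne.symm ht))] with s hs
        exact h.sum_time hl (le_of_lt hs)
      exact h1.unique h2
    · by_contra hzi
      exact hi (h.deriv_time_eq_zero hl hC hH hS hj hzi)
  · have hg : LipschitzWith (Fintype.card ι * C).toNNReal (fun t => ∫ τ in T..t, φ τ) := by
      refine LipschitzWith.of_dist_le_mul fun a b => ?_
      rw [Real.coe_toNNReal _ (by positivity), dist_eq_norm,
        intervalIntegral.integral_interval_sub_left (hφint _ _) (hφint _ _), Real.dist_eq]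
      exact intervalIntegral.norm_integral_le_of_norm_le_const fun x _ => hφb x
    -- Both terms are Lipschitz with the same derivative almost everywhere; absolute continuity
    -- makes their difference constant.
    have hac : AbsolutelyContinuousOnInterval (fun t => z t - ∫ τ in T..t, φ τ) T t :=
      (hz.lipschitzOnWith.absolutelyContinuousOnInterval).fun_sub
        hg.lipschitzOnWith.absolutelyContinuousOnInterval
    obtain ⟨c, hc⟩ := hac.const_of_ae_hasDerivAt_zero (by
      filter_upwards [hdiff, (hφint T t).ae_hasDerivAt_integral] with x hx1 hx2 hx
      have := (h.hasDerivAt_node hl hC hH hx1).sub (hx2 hx T left_mem_uIcc)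
      rwa [hφ, sub_self] at this)
    have h1 := hc T left_mem_uIcc
    have h2 := hc t right_mem_uIcc
    rw [intervalIntegral.integral_same, sub_zero, h.initial] at h1
    rw [h1]
    exact sub_eq_iff_eq_add.1 h2

end Filippov

end ISMPC

namespace ISMPC

variable {n m l : ℕ}

/-! ### Extended vectors -/

lemma norm_le_card_mul {κ : Type*} [Fintype κ] {x : EuclideanSpace ℝ κ} {δ : ℝ}
    (hx : ∀ k, |x k| ≤ δ) : ‖x‖ ≤ Fintype.card κ * δ := by
  have h1 : ‖x‖ ≤ ∑ k, ‖x k‖ := by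
    rw [EuclideanSpace.norm_eq]
    refine Real.sqrt_le_iff.2 ⟨Finset.sum_nonneg fun _ _ => norm_nonneg _, ?_⟩
    exact Finset.sum_sq_le_sq_sum_of_nonneg fun _ _ => norm_nonneg _
  refine h1.trans ?_
  calc _ ≤ ∑ _k : κ, δ := Finset.sum_le_sum fun k _ => hx k
    _ = _ := by simp

/-- The projection `[x, u] ↦ x` as a continuous linear map. -/
def stL : XVec n m →L[ℝ] Vec n :=
  LinearMap.toContinuousLinearMap
    { toFun := st, map_add' := fun _ _ => rfl, map_smul' := fun _ _ => rfl }

/-- The projection `[x, u] ↦ u` as a continuous linear map. -/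
def inpL : XVec n m →L[ℝ] Vec m :=
  LinearMap.toContinuousLinearMap
    { toFun := inp, map_add' := fun _ _ => rfl, map_smul' := fun _ _ => rfl }

/-- The map `(x, u) ↦ [x, u]` as a continuous linear map. -/
def joinL : Vec n × Vec m →L[ℝ] XVec n m :=
  LinearMap.toContinuousLinearMap
    { toFun := fun q => joinVec q.1 q.2
      map_add' := fun a b => by ext i; cases i <;> rfl
      map_smul' := fun a b => by ext i; cases i <;> rfl }

lemma stL_apply (z : XVec n m) : stL z = st z := rfl

lemma inpL_apply (z : XVec n m) : inpL z = inp z := rfl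

lemma joinL_apply (q : Vec n × Vec m) : joinL q = joinVec q.1 q.2 := rfl

lemma st_joinVec (x : Vec n) (u : Vec m) : st (joinVec x u) = x := rfl

lemma inp_joinVec (x : Vec n) (u : Vec m) : inp (joinVec x u) = u := rfl

lemma joinVec_st_inp (z : XVec n m) : joinVec (st z) (inp z) = z := by
  ext i; cases i <;> rfl

lemma ext_st_inp {z z' : XVec n m} (h1 : st z = st z') (h2 : inp z = inp z') : z = z' := by
  rw [← joinVec_st_inp z, h1, h2, joinVec_st_inp]

@[fun_prop]
lemma continuous_st : Continuous (st : XVec n m → Vec n) := (stL (n := n) (m := m)).continuous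

@[fun_prop]
lemma continuous_inp : Continuous (inp : XVec n m → Vec m) := (inpL (n := n) (m := m)).continuous

lemma continuous_joinVec : Continuous fun q : Vec n × Vec m => joinVec q.1 q.2 :=
  (joinL (n := n) (m := m)).continuous

lemma norm_joinVec_sq (x : Vec n) (u : Vec m) : ‖joinVec x u‖ ^ 2 = ‖x‖ ^ 2 + ‖u‖ ^ 2 := by
  simp [EuclideanSpace.norm_sq_eq, joinVec]

lemma norm_joinVec_le (x : Vec n) (u : Vec m) : ‖joinVec x u‖ ≤ ‖x‖ + ‖u‖ := by
  have := norm_joinVec_sq x u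
  nlinarith [norm_nonneg x, norm_nonneg u, norm_nonneg (joinVec x u),
    mul_nonneg (norm_nonneg x) (norm_nonneg u)]

lemma norm_joinVec_zero (u : Vec m) : ‖joinVec (0 : Vec n) u‖ = ‖u‖ := by
  have := norm_joinVec_sq (0 : Vec n) u
  rw [norm_zero, zero_pow two_ne_zero, zero_add] at this
  exact (sq_eq_sq₀ (norm_nonneg _) (norm_nonneg _)).1 this

lemma joinVec_sub (x x' : Vec n) (u u' : Vec m) :
    joinVec x u - joinVec x' u' = joinVec (x - x') (u - u') := by
  ext i; cases i <;> rfl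

/-! ### Cells and their weights -/

lemma IsPolyhedron.isClosed {P : Set (Vec n)} (h : IsPolyhedron P) : IsClosed P := by
  obtain ⟨k, a, b, rfl⟩ := h
  simp only [ofPred_forall]
  exact isClosed_iInter fun j => isClosed_le (by fun_prop) continuous_const

lemma isClosed_rect {X : Set (Vec n)} {U : Set (Vec m)} (hX : IsClosed X) (hU : IsClosed U) :
    IsClosed (rect X U) :=
  (hX.preimage continuous_st).inter (hU.preimage continuous_inp)

variable {f : XVec n m → Vec n} {X : Set (Vec n)} {U : Set (Vec m)} {p : PWAModel f X U l}
  {c : Gains n m l} {Sx : Vec n →L[ℝ] Vec m} {Su : Vec m ≃L[ℝ] Vec m} {γ T : ℝ}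
  {z : ℝ → XVec n m} {w : ℝ → Fin (l + 1) → ℝ}

lemma PWAModel.isClosed_cell (p : PWAModel f X U l) (hX : IsClosed X) (hU : IsClosed U)
    (i : Fin (l + 1)) : IsClosed (p.cell i) :=
  isClosed_rect (hX.inter (p.polyhedron_P i).1.isClosed) (hU.inter (p.polyhedron_Q i).1.isClosed)

lemma PWAModel.exists_mem_cell (p : PWAModel f X U l) {z : XVec n m} (hz : z ∈ rect X U) :
    ∃ i, z ∈ p.cell i := by
  obtain ⟨i, hi⟩ := mem_iUnion.1 (p.cover hz)
  exact ⟨i, ⟨hz.1, hi.1⟩, hz.2, hi.2⟩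

lemma PWAModel.continuous_nominal (p : PWAModel f X U l) (i : Fin (l + 1)) :
    Continuous (p.nominal i) := by
  unfold PWAModel.nominal
  fun_prop

lemma Gains.continuous_law (c : Gains n m l) (i : Fin (l + 1)) : Continuous (c.law i) := by
  unfold Gains.law
  fun_prop

lemma continuous_switchGain (p : PWAModel f X U l) (Sx : Vec n →L[ℝ] Vec m) (γ : ℝ)
    (i : Fin (l + 1)) : Continuous (switchGain p Sx γ i) := by
  unfold switchGain
  split_ifs <;> fun_prop

/-- The effect `S_x [ΔA_i x + ΔB_i u + ΔC_i]` of the model error on the sliding variable. -/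
def mismatch (p : PWAModel f X U l) (Sx : Vec n →L[ℝ] Vec m) (i : Fin (l + 1)) (z : XVec n m) :
    Vec m :=
  Sx (f z - p.nominal i z)

lemma continuous_mismatch (hf : Continuous f) (p : PWAModel f X U l) (Sx : Vec n →L[ℝ] Vec m)
    (i : Fin (l + 1)) : Continuous (mismatch p Sx i) :=
  Sx.continuous.comp (hf.sub (p.continuous_nominal i))

lemma le_switchGain (p : PWAModel f X U l) (Sx : Vec n →L[ℝ] Vec m) (γ : ℝ) (i : Fin (l + 1))
    (z : XVec n m) : γ ≤ switchGain p Sx γ i z := by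
  have h0 := mul_nonneg (mul_nonneg p.εf0_nonneg (norm_nonneg Sx)) (norm_nonneg z)
  have h1 := mul_nonneg (mul_nonneg p.εf_nonneg (norm_nonneg Sx)) (norm_nonneg z)
  have h2 := mul_nonneg p.εg_nonneg (norm_nonneg Sx)
  unfold switchGain
  split_ifs <;> linarith

/-- This is the reaching condition: `β_i + σ_i` is the bound on the effect of the model error in the
cell `i`, and `γ` is the reserve. In the cell `0` there is no constant term because `C 0 = 0`. -/
lemma norm_mismatch_add_le (p : PWAModel f X U l) (Sx : Vec n →L[ℝ] Vec m) (γ : ℝ)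
    {i : Fin (l + 1)} {z : XVec n m} (hz : z ∈ p.cell i) :
    ‖mismatch p Sx i z‖ + γ ≤ switchGain p Sx γ i z := by
  unfold switchGain
  split_ifs with hi
  · subst hi
    obtain ⟨Δ, hΔ, hfz⟩ := p.approx_zero z hz
    have h1 : f z - p.nominal 0 z = Δ z := by
      rw [hfz, PWAModel.nominal, p.C_zero]
      abel
    have h2 : ‖mismatch p Sx 0 z‖ ≤ ‖Sx‖ * (p.εf0 * ‖z‖) := by
      rw [mismatch, h1]
      exact Sx.le_opNorm_of_le (Δ.le_of_opNorm_le hΔ z)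
    linarith
  · obtain ⟨Δ, δ, hΔ, hδ, hfz⟩ := p.approx i hi z hz
    have h1 : f z - p.nominal i z = Δ z + δ := by
      rw [hfz, PWAModel.nominal]
      abel
    have h2 : ‖mismatch p Sx i z‖ ≤ ‖Sx‖ * (p.εf * ‖z‖ + p.εg) := by
      rw [mismatch, h1]
      exact Sx.le_opNorm_of_le ((norm_add_le _ _).trans (add_le_add (Δ.le_of_opNorm_le hΔ z) hδ))
    linarith

namespace IsCellWeight

lemma norm_le_one (hw : IsCellWeight p T z w) (i : Fin (l + 1)) :
    ∀ᵐ t ∂volume.restrict (Icc 0 T), ‖w t i‖ ≤ 1 := by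
  filter_upwards [hw.nonneg, hw.sum_eq_one] with t h1 h2
  rw [Real.norm_of_nonneg (h1 i), ← h2]
  exact Finset.single_le_sum (fun j _ => h1 j) (Finset.mem_univ i)

lemma integrableOn_smul {V : Type*} [NormedAddCommGroup V] [NormedSpace ℝ V]
    (hw : IsCellWeight p T z w) (i : Fin (l + 1)) {ψ : ℝ → V} (hψ : IntegrableOn ψ (Icc 0 T)) :
    IntegrableOn (fun τ => w τ i • ψ τ) (Icc 0 T) :=
  hψ.bdd_smul 1 (hw.measurable i).aestronglyMeasurable (hw.norm_le_one i)

lemma integrableOn_sum {V : Type*} [NormedAddCommGroup V] [NormedSpace ℝ V]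
    (hw : IsCellWeight p T z w) {ψ : Fin (l + 1) → ℝ → V}
    (hψ : ∀ i, IntegrableOn (ψ i) (Icc 0 T)) :
    IntegrableOn (fun τ => ∑ i, w τ i • ψ i τ) (Icc 0 T) :=
  integrable_finsetSum _ fun i _ => hw.integrableOn_smul i (hψ i)

lemma mono (hw : IsCellWeight p T z w) {t : ℝ} (ht : t ≤ T) : IsCellWeight p t z w :=
  have h : Icc (0 : ℝ) t ⊆ Icc 0 T := Icc_subset_Icc_right ht
  ⟨hw.measurable, ae_restrict_of_ae_restrict_of_subset h hw.nonneg,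
    ae_restrict_of_ae_restrict_of_subset h hw.sum_eq_one,
    ae_restrict_of_ae_restrict_of_subset h hw.support⟩

end IsCellWeight

lemma intervalIntegrable_of_integrableOn_Icc {V : Type*} [NormedAddCommGroup V] {ψ : ℝ → V}
    (hψ : IntegrableOn ψ (Icc 0 T)) {s t : ℝ} (hs : s ∈ Icc 0 T) (ht : t ∈ Icc 0 T) :
    IntervalIntegrable ψ volume s t :=
  intervalIntegrable_iff.2 <| hψ.mono_set <|
    uIoc_subset_uIcc.trans (uIcc_subset_Icc hs ht)

lemma integral_congr_ae_Icc {V : Type*} [NormedAddCommGroup V] [NormedSpace ℝ V] {ψ ψ' : ℝ → V}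
    (h : ∀ᵐ τ ∂volume.restrict (Icc 0 T), ψ τ = ψ' τ) {s t : ℝ} (hs : s ∈ Icc 0 T)
    (ht : t ∈ Icc 0 T) : ∫ τ in s..t, ψ τ = ∫ τ in s..t, ψ' τ := by
  refine intervalIntegral.integral_congr_ae ?_
  rw [ae_restrict_iff' measurableSet_Icc] at h
  filter_upwards [h] with τ h1 h2
  exact h1 (uIcc_subset_Icc hs ht (uIoc_subset_uIcc h2))

lemma integrableOn_comp_Icc {V : Type*} [NormedAddCommGroup V] {φ : XVec n m → V}
    (hφ : Continuous φ) (hz : ContinuousOn z (Icc 0 T)) :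
    IntegrableOn (fun τ => φ (z τ)) (Icc 0 T) :=
  (hφ.comp_continuousOn hz).integrableOn_Icc

/-! ### The sliding surface -/

/-- If the input moves with the nominal law corrected by `-S_u⁻¹ q_i`, the sliding variable
integrates the difference between the model error and `q_i`. -/
lemma slidingVar_eq_integral (hf : Continuous f) (hz : ContinuousOn z (Icc 0 T))
    (hw : IsCellWeight p T z w)
    (hplant : ∀ t ∈ Icc 0 T, st (z t) = st (z 0) + ∫ τ in (0 : ℝ)..t, f (z τ))
    {q : Fin (l + 1) → ℝ → Vec m} (hq : ∀ i, IntegrableOn (q i) (Icc 0 T))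
    (hcontrol : ∀ t ∈ Icc 0 T, inp (z t) = inp (z 0) + ∫ τ in (0 : ℝ)..t,
      ∑ i, w τ i • (c.law i (z τ) - Su.symm (q i τ))) {t : ℝ} (ht : t ∈ Icc 0 T) :
    slidingVar p c Sx Su z w t
      = ∫ τ in (0 : ℝ)..t, ∑ i, w τ i • (mismatch p Sx i (z τ) - q i τ) := by
  have h0 : (0 : ℝ) ∈ Icc 0 T := ⟨le_rfl, ht.1.trans ht.2⟩
  have hI : ∀ {V : Type} [NormedAddCommGroup V] {ψ : ℝ → V}, IntegrableOn ψ (Icc 0 T) →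
      IntervalIntegrable ψ volume 0 t := fun h => intervalIntegrable_of_integrableOn_Icc h h0 ht
  have hL := fun i => integrableOn_comp_Icc (c.continuous_law i) hz
  have hN := fun i => integrableOn_comp_Icc (p.continuous_nominal i) hz
  have hfI := integrableOn_comp_Icc hf hz
  have hG : IntegrableOn (fun τ => ∑ i, w τ i • (c.law i (z τ) - Su.symm (q i τ))) (Icc 0 T) :=
    hw.integrableOn_sum fun i => (hL i).sub
      ((Su.symm : Vec m →L[ℝ] Vec m).integrable_comp (hq i))
  have e1 : Sx (∫ τ in (0 : ℝ)..t, f (z τ)) = ∫ τ in (0 : ℝ)..t, Sx (f (z τ)) :=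
    (Sx.intervalIntegral_comp_comm (hI hfI)).symm
  have e2 : Su (∫ τ in (0 : ℝ)..t, ∑ i, w τ i • (c.law i (z τ) - Su.symm (q i τ)))
      = ∫ τ in (0 : ℝ)..t, Su (∑ i, w τ i • (c.law i (z τ) - Su.symm (q i τ))) :=
    ((Su : Vec m →L[ℝ] Vec m).intervalIntegral_comp_comm (hI hG)).symm
  have i1 := hI (Sx.integrable_comp hfI)
  have i2 := hI ((Su : Vec m →L[ℝ] Vec m).integrable_comp hG)
  have i3 := hI (hw.integrableOn_sum fun i => Sx.integrable_comp (hN i))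
  have i4 := hI (hw.integrableOn_sum fun i => (Su : Vec m →L[ℝ] Vec m).integrable_comp (hL i))
  simp only [ContinuousLinearEquiv.coe_coe] at i2 i4
  rw [slidingVar, hplant t ht, hcontrol t ht, add_sub_cancel_left, add_sub_cancel_left, e1, e2,
    ← intervalIntegral.integral_add i1 i2, ← intervalIntegral.integral_sub (i1.add i2) i3,
    ← intervalIntegral.integral_sub ((i1.add i2).sub i3) i4]
  refine integral_congr_ae_Icc ?_ h0 ht
  filter_upwards [hw.sum_eq_one] with τ hτ
  -- The plant does not depend on the cell; distributing it over the weights lets the terms be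
  -- compared cell by cell.
  have h1 : Sx (f (z τ)) = ∑ i, w τ i • Sx (f (z τ)) := by
    rw [← Finset.sum_smul, hτ, one_smul]
  rw [h1, map_sum, ← Finset.sum_add_distrib, ← Finset.sum_sub_distrib, ← Finset.sum_sub_distrib]
  refine Finset.sum_congr rfl fun i _ => ?_
  simp only [map_smul, map_sub, mismatch, ContinuousLinearEquiv.apply_symm_apply, smul_sub]
  abel

/-- A primitive that decreases wherever it is positive stays nonpositive. -/
lemma integral_nonpos_of_nonpos_where_pos {σ s : ℝ → ℝ} (hσ : IntegrableOn σ (Icc 0 T))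
    (hs : ∀ t ∈ Icc 0 T, s t = ∫ τ in (0 : ℝ)..t, σ τ)
    (h : ∀ᵐ t ∂volume.restrict (Icc 0 T), 0 < s t → σ t ≤ 0) : ∀ t ∈ Icc 0 T, s t ≤ 0 := by
  intro t₁ ht₁
  by_contra! hpos
  have hT : 0 ≤ T := ht₁.1.trans ht₁.2
  have hcont : ContinuousOn s (Icc 0 t₁) := by
    have h1 : ContinuousOn (fun t => ∫ τ in (0 : ℝ)..t, σ τ) (Icc 0 T) := by
      have := intervalIntegral.continuousOn_primitive_interval (a := 0) (b := T)
        (f := σ) (μ := volume) (by rwa [uIcc_of_le hT])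
      rwa [uIcc_of_le hT] at this
    exact (h1.congr hs).mono (Icc_subset_Icc_right ht₁.2)
  have hK : IsCompact (Icc 0 t₁ ∩ s ⁻¹' Iic 0) :=
    isCompact_Icc.of_isClosed_subset (hcont.preimage_isClosed_of_isClosed isClosed_Icc isClosed_Iic)
      inter_subset_left
  have h00 : s 0 = 0 := by rw [hs 0 ⟨le_rfl, hT⟩, intervalIntegral.integral_same]
  -- `t₀` is the last time before `t₁` with `s ≤ 0`. On `(t₀, t₁]` the primitive is positive, so its
  -- integrand is nonpositive there and `s t₁ ≤ s t₀`.
  obtain ⟨t₀, ⟨ht₀, hs₀⟩, hmax⟩ := hK.exists_isGreatest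
    ⟨0, ⟨le_rfl, ht₁.1⟩, by simp [h00]⟩
  have ht₀T : t₀ ∈ Icc 0 T := ⟨ht₀.1, ht₀.2.trans ht₁.2⟩
  have hI : ∀ {a b}, a ∈ Icc 0 T → b ∈ Icc 0 T → IntervalIntegrable σ volume a b :=
    fun ha hb => intervalIntegrable_of_integrableOn_Icc hσ ha hb
  have h1 : s t₁ = s t₀ + ∫ τ in t₀..t₁, σ τ := by
    rw [hs t₁ ht₁, hs t₀ ht₀T, intervalIntegral.integral_add_adjacent_intervals
      (hI ⟨le_rfl, hT⟩ ht₀T) (hI ht₀T ht₁)]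
  have h2 : ∫ τ in t₀..t₁, σ τ ≤ 0 := by
    rw [intervalIntegral.integral_of_le ht₀.2]
    refine integral_nonpos_of_ae ?_
    have hsub : Ioc t₀ t₁ ⊆ Icc 0 T := fun x hx => ⟨ht₀.1.trans hx.1.le, hx.2.trans ht₁.2⟩
    have h3 := ae_restrict_of_ae_restrict_of_subset hsub h
    filter_upwards [h3, ae_restrict_mem measurableSet_Ioc] with τ h4 h5
    refine h4 (not_le.1 fun h6 => ?_)
    exact absurd (hmax ⟨⟨ht₀.1.trans h5.1.le, h5.2⟩, h6⟩) (not_le.2 h5.1)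
  have h3 : s t₀ ≤ 0 := hs₀
  linarith

lemma integral_eq_zero_of_sign {σ s : ℝ → ℝ} (hσ : IntegrableOn σ (Icc 0 T))
    (hs : ∀ t ∈ Icc 0 T, s t = ∫ τ in (0 : ℝ)..t, σ τ)
    (h : ∀ᵐ t ∂volume.restrict (Icc 0 T), (0 < s t → σ t ≤ 0) ∧ (s t < 0 → 0 ≤ σ t)) :
    ∀ t ∈ Icc 0 T, s t = 0 := by
  intro t ht
  refine le_antisymm (integral_nonpos_of_nonpos_where_pos hσ hs (h.mono fun _ h => h.1) t ht) ?_
  have := integral_nonpos_of_nonpos_where_pos (σ := fun τ => -σ τ) (s := fun τ => -s τ) hσ.neg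
    (fun t ht => by rw [hs t ht, intervalIntegral.integral_neg])
    (h.mono fun t h h1 => by linarith [h.2 (by linarith)]) t ht
  linarith

namespace IsClosedLoopSolution

variable {v : ℝ → Fin (l + 1) → Vec m}

lemma integrableOn_switching (h : IsClosedLoopSolution p c Sx Su γ T z w v) (i : Fin (l + 1)) :
    IntegrableOn (fun τ => switchGain p Sx γ i (z τ) • v τ i) (Icc 0 T) := by
  refine Integrable.smul_bdd (β := Vec m) (𝕜 := ℝ)
    (integrableOn_comp_Icc (continuous_switchGain p Sx γ i) h.continuousOn) (m : ℝ)
    (h.measurable i).aestronglyMeasurable ?_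
  filter_upwards [h.sgn] with t ht
  simpa using norm_le_card_mul fun k => (ht i k).2.2

lemma control' (h : IsClosedLoopSolution p c Sx Su γ T z w v) :
    ∀ t ∈ Icc 0 T, inp (z t) = inp (z 0) + ∫ τ in (0 : ℝ)..t,
      ∑ i, w τ i • (c.law i (z τ) - Su.symm (switchGain p Sx γ i (z τ) • v τ i)) := by
  simpa only [map_smul] using h.control

/-- The sliding surface `s = 0` is kept from the initial time on. -/
theorem slidingVar_eq_zero (hf : Continuous f) (hγ : 0 ≤ γ)
    (h : IsClosedLoopSolution p c Sx Su γ T z w v) :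
    ∀ t ∈ Icc 0 T, slidingVar p c Sx Su z w t = 0 := by
  have hmis := fun i => integrableOn_comp_Icc (continuous_mismatch hf p Sx i) h.continuousOn
  have hσ : IntegrableOn (fun τ => ∑ i, w τ i • (mismatch p Sx i (z τ)
      - switchGain p Sx γ i (z τ) • v τ i)) (Icc 0 T) :=
    h.weight.integrableOn_sum fun i => (hmis i).sub (h.integrableOn_switching i)
  have hs : ∀ t ∈ Icc 0 T, slidingVar p c Sx Su z w t = ∫ τ in (0 : ℝ)..t,
      ∑ i, w τ i • (mismatch p Sx i (z τ) - switchGain p Sx γ i (z τ) • v τ i) := fun t ht =>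
    slidingVar_eq_integral hf h.continuousOn h.weight h.plant h.integrableOn_switching h.control' ht
  intro t ht
  ext k
  have hproj := (EuclideanSpace.proj k : Vec m →L[ℝ] ℝ).integrable_comp hσ
  refine integral_eq_zero_of_sign (s := fun t => slidingVar p c Sx Su z w t k) hproj ?_ ?_ t ht
  · intro t ht
    have h0 : (0 : ℝ) ∈ Icc 0 T := ⟨le_rfl, ht.1.trans ht.2⟩
    rw [(EuclideanSpace.proj k : Vec m →L[ℝ] ℝ).intervalIntegral_comp_comm
      (intervalIntegrable_of_integrableOn_Icc hσ h0 ht), ← hs t ht]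
    rfl
  · filter_upwards [h.sgn, h.weight.nonneg, h.weight.support] with τ h1 h2 h3
    have hval : (EuclideanSpace.proj k : Vec m →L[ℝ] ℝ) (∑ i, w τ i • (mismatch p Sx i (z τ)
        - switchGain p Sx γ i (z τ) • v τ i)) = ∑ i, w τ i * (mismatch p Sx i (z τ) k
        - switchGain p Sx γ i (z τ) * v τ i k) := by
      simp
    -- The model bounds hold only in cells containing the current point, which are the only ones
    -- with non-zero weight.
    have hb : ∀ i, w τ i ≠ 0 → |mismatch p Sx i (z τ) k| ≤ switchGain p Sx γ i (z τ) := by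
      intro i hi
      have := norm_mismatch_add_le p Sx γ (h3 i hi)
      have h5 := PiLp.norm_apply_le (mismatch p Sx i (z τ)) k
      rw [Real.norm_eq_abs] at h5
      linarith
    rw [hval]
    constructor
    · intro hpos
      refine Finset.sum_nonpos fun i _ => ?_
      by_cases hi : w τ i = 0
      · simp [hi]
      · rw [(h1 i k).1 hpos]
        exact mul_nonpos_of_nonneg_of_nonpos (h2 i) (by linarith [(abs_le.1 (hb i hi)).2])
    · intro hneg
      refine Finset.sum_nonneg fun i _ => ?_
      by_cases hi : w τ i = 0
      · simp [hi]
      · rw [(h1 i k).2.1 hneg]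
        exact mul_nonneg (h2 i) (by linarith [(abs_le.1 (hb i hi)).1])

/-- Closed-loop solutions are sliding motions. -/
theorem isSlidingMotion (hf : Continuous f) (hγ : 0 ≤ γ)
    (h : IsClosedLoopSolution p c Sx Su γ T z w v) : IsSlidingMotion p c Sx Su T z w := by
  refine ⟨h.continuousOn, h.mem, h.weight, h.plant, fun t ht => ?_⟩
  have h0 : (0 : ℝ) ∈ Icc 0 T := ⟨le_rfl, ht.1.trans ht.2⟩
  have hI : ∀ {V : Type} [NormedAddCommGroup V] {ψ : ℝ → V}, IntegrableOn ψ (Icc 0 T) →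
      IntervalIntegrable ψ volume 0 t := fun h => intervalIntegrable_of_integrableOn_Icc h h0 ht
  have hmis := fun i => integrableOn_comp_Icc (continuous_mismatch hf p Sx i) h.continuousOn
  have hL := fun i => integrableOn_comp_Icc (c.continuous_law i) h.continuousOn
  have hsw := h.integrableOn_switching
  have hσ : IntegrableOn (fun τ => ∑ i, w τ i • (mismatch p Sx i (z τ)
      - switchGain p Sx γ i (z τ) • v τ i)) (Icc 0 T) :=
    h.weight.integrableOn_sum fun i => (hmis i).sub (hsw i)
  have h1 := slidingVar_eq_integral (Sx := Sx) hf h.continuousOn h.weight h.plant hsw h.control' ht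
  rw [h.slidingVar_eq_zero hf hγ t ht] at h1
  have h2 := (Su.symm : Vec m →L[ℝ] Vec m).intervalIntegral_comp_comm (hI hσ)
  rw [← h1, map_zero] at h2
  have i1 : IntervalIntegrable (fun τ => ∑ i, w τ i • (c.law i (z τ)
      - Su.symm (switchGain p Sx γ i (z τ) • v τ i))) volume 0 t :=
    hI (h.weight.integrableOn_sum fun i => (hL i).sub
      ((Su.symm : Vec m →L[ℝ] Vec m).integrable_comp (hsw i)))
  have i2 := hI ((Su.symm : Vec m →L[ℝ] Vec m).integrable_comp hσ)
  rw [h.control' t ht]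
  congr 1
  -- Since `s = 0`, the integral in `h2` vanishes; subtracting it exchanges the switching term for
  -- the mismatch. Only the integrals are compared, so nothing has to be differentiated.
  rw [← sub_zero (∫ τ in (0 : ℝ)..t, _), ← h2, ← intervalIntegral.integral_sub i1 i2]
  congr 1
  ext1 τ
  simp only [ContinuousLinearEquiv.coe_coe]
  rw [map_sum, ← Finset.sum_sub_distrib]
  refine Finset.sum_congr rfl fun i _ => ?_
  simp only [map_smul, map_sub, mismatch, smul_sub]
  abel

end IsClosedLoopSolution

/-- A sliding motion on `[0, ∞)` is realized by the controller. -/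
theorem exists_isClosedLoopSolution (hf : Continuous f) (hγ : 0 < γ)
    (h : ∀ T, 0 ≤ T → IsSlidingMotion p c Sx Su T z w) :
    ∃ v, ∀ T, 0 ≤ T → IsClosedLoopSolution p c Sx Su γ T z w v := by
  -- In an active cell the maximum is the switching gain, so `φ` reproduces the mismatch. Elsewhere
  -- the maximum keeps the norm at most `1`, since the selections of inactive cells must be
  -- admissible too.
  let φ : Fin (l + 1) → XVec n m → Vec m := fun i x =>
    (max (switchGain p Sx γ i x) ‖mismatch p Sx i x‖)⁻¹ • mismatch p Sx i x
  have hpos : ∀ i x, 0 < max (switchGain p Sx γ i x) ‖mismatch p Sx i x‖ := fun i x =>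
    lt_max_of_lt_left (hγ.trans_le (le_switchGain p Sx γ i x))
  have hφ : ∀ i, Continuous (φ i) := fun i =>
    (((continuous_switchGain p Sx γ i).max (continuous_mismatch hf p Sx i).norm).inv₀
      fun x => (hpos i x).ne').smul (continuous_mismatch hf p Sx i)
  have hzc : ContinuousOn z (Ici 0) := by
    intro t ht
    have := (h (t + 1) (by linarith [mem_Ici.1 ht])).continuousOn t
      ⟨ht, by linarith⟩
    refine this.mono_of_mem_nhdsWithin ?_
    filter_upwards [self_mem_nhdsWithin, mem_nhdsWithin_of_mem_nhds
      (Iio_mem_nhds (show t < t + 1 by linarith))] with s h1 h2 using ⟨h1, le_of_lt h2⟩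
  -- Nothing is known about `z` at negative times, whereas the selection must be measurable on the
  -- whole line.
  have hzm : Continuous fun t => z (max 0 t) :=
    hzc.comp_continuous (by fun_prop) fun t => mem_Ici.2 (le_max_left _ _)
  refine ⟨fun t i => φ i (z (max 0 t)), fun T hT => ?_⟩
  have hs := h T hT
  -- With `q` equal to the mismatch the integrand vanishes. At `s = 0` any vector with components in
  -- `[-1, 1]` is an admissible sign.
  have hzero : ∀ t ∈ Icc 0 T, slidingVar p c Sx Su z w t = 0 := fun t ht => by
    rw [slidingVar_eq_integral (Sx := Sx) hf hs.continuousOn hs.weight hs.plant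
      (q := fun i τ => mismatch p Sx i (z τ))
      (fun i => integrableOn_comp_Icc (continuous_mismatch hf p Sx i) hs.continuousOn) hs.control ht]
    simp
  refine ⟨hs.continuousOn, hs.mem, hs.weight, fun i => ((hφ i).comp hzm).measurable, ?_, hs.plant,
    fun t ht => ?_⟩
  · filter_upwards [ae_restrict_mem measurableSet_Icc] with t ht i k
    rw [hzero t ht]
    refine ⟨fun h => absurd h (lt_irrefl _), fun h => absurd h (lt_irrefl _), ?_⟩
    rw [← Real.norm_eq_abs]
    refine (PiLp.norm_apply_le _ k).trans ?_
    rw [norm_smul, norm_inv, Real.norm_of_nonneg (hpos i _).le, inv_mul_le_iff₀ (hpos i _), mul_one]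
    exact le_max_right _ _
  · rw [hs.control t ht]
    congr 1
    refine integral_congr_ae_Icc (T := T) ?_ ⟨le_rfl, hT⟩ ht
    filter_upwards [hs.weight.support, ae_restrict_mem measurableSet_Icc] with τ h1 hτ
    refine Finset.sum_congr rfl fun i _ => ?_
    by_cases hi : w τ i = 0
    · simp [hi]
    have h2 := norm_mismatch_add_le p Sx γ (h1 i hi)
    have h3 : max (switchGain p Sx γ i (z τ)) ‖mismatch p Sx i (z τ)‖
        = switchGain p Sx γ i (z τ) := max_eq_left (by linarith)
    have h4 : switchGain p Sx γ i (z τ) ≠ 0 := (h3 ▸ hpos i (z τ)).ne'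
    simp only [φ, max_eq_right hτ.1, h3]
    rw [← map_smul, smul_inv_smul₀ h4]
    rfl

end ISMPC

namespace ISMPC

/-! ### Exponential decay under relatively small perturbations -/

section Decay

variable {E : Type*} [NormedAddCommGroup E] [NormedSpace ℝ E]

/-- Grönwall's inequality in integral form: the right-hand integral satisfies the differential
inequality. Extending `d` by constants beyond the interval makes this integral differentiable
everywhere. -/
lemma le_exp_of_le_integral {d : ℝ → ℝ} {K b r : ℝ} (hK : 0 < K) (hb : 0 ≤ b)
    (hd : ContinuousOn d (Icc 0 r)) (hd0 : ∀ t ∈ Icc 0 r, 0 ≤ d t)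
    (h : ∀ t ∈ Icc 0 r, d t ≤ ∫ τ in (0 : ℝ)..t, (K * d τ + b)) :
    ∀ t ∈ Icc 0 r, d t ≤ b / K * (Real.exp (K * t) - 1) := by
  intro t₁ ht₁
  have hr : 0 ≤ r := ht₁.1.trans ht₁.2
  set e : ℝ → ℝ := IccExtend hr ((Icc 0 r).domRestrict d) with he
  have hec : Continuous e := (continuousOn_iff_continuous_domRestrict.1 hd).Icc_extend'
  have hed : ∀ t ∈ Icc 0 r, e t = d t := fun t ht => by
    rw [he, IccExtend_of_mem _ _ ht, domRestrict_apply]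
  have hc : Continuous fun τ => K * e τ + b := by fun_prop
  have hD : ∀ t, HasDerivAt (fun t => ∫ τ in (0 : ℝ)..t, (K * e τ + b)) (K * e t + b) t :=
    fun t => (hc.integral_hasStrictDerivAt 0 t).hasDerivAt
  have hle : ∀ t ∈ Icc 0 r, e t ≤ ∫ τ in (0 : ℝ)..t, (K * e τ + b) := fun t ht => by
    have h1 : ∫ τ in (0 : ℝ)..t, (K * e τ + b) = ∫ τ in (0 : ℝ)..t, (K * d τ + b) := by
      refine intervalIntegral.integral_congr fun τ hτ => ?_
      rw [uIcc_of_le ht.1] at hτ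
      simp only [hed τ ⟨hτ.1, hτ.2.trans ht.2⟩]
    rw [h1, hed t ht]
    exact h t ht
  have h2 := norm_le_gronwallBound_of_norm_deriv_right_le (δ := 0) (K := K) (ε := b) (a := 0)
    (b := r) (fun t _ => (hD t).continuousAt.continuousWithinAt)
    (fun t _ => (hD t).hasDerivWithinAt) (by simp) (fun t ht => by
      have ht' : t ∈ Icc 0 r := ⟨ht.1, ht.2.le⟩
      have h3 : 0 ≤ e t := by rw [hed t ht']; exact hd0 t ht'
      rw [Real.norm_of_nonneg (by positivity)]
      have := (hle t ht').trans (Real.le_norm_self _)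
      gcongr) t₁ ht₁
  simp only [gronwallBound_of_K_ne_0 hK.ne', sub_zero, zero_mul, zero_add] at h2
  rw [← hed t₁ ht₁]
  exact (hle t₁ ht₁).trans ((Real.le_norm_self _).trans h2)

/-- `z` moves on `[0, T]`, within the ball of radius `R`, along the field `F` up to a perturbation
of relative size `η`. -/
structure IsPerturbedSolution (F : E → E) (η R T : ℝ) (z : ℝ → E) : Prop where
  continuousOn : ContinuousOn z (Icc 0 T)
  norm_le : ∀ t ∈ Icc 0 T, ‖z t‖ ≤ R
  close : ∀ s t, 0 ≤ s → s ≤ t → t ≤ T →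
    ‖z t - z s - ∫ τ in s..t, F (z τ)‖ ≤ ∫ τ in s..t, η * ‖z τ‖

variable [CompleteSpace E] {F : E → E} {k a η R T T₀ : ℝ} {L : NNReal} {z : ℝ → E}

/-- Compare `z` with the exact solution `y` that starts at `z s`; it stays in the ball of radius `k
* R`, where `F` is Lipschitz. Since `‖z‖ ≤ ‖z - y‖ + k * ‖z s‖`, the perturbation adds `η ≤ 1` to
the Lipschitz constant and a source `η * k * ‖z s‖`. Grönwall then bounds the deviation over a time
`T₀` by `‖z s‖ / 4`. -/
lemma IsPerturbedSolution.norm_le_of_sub_le (h : IsPerturbedSolution F η R T z) (hF : Continuous F)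
    (hex : ∀ z₀, ∃ y : ℝ → E, y 0 = z₀ ∧ ∀ t, 0 ≤ t → HasDerivWithinAt y (F (y t)) (Ici 0) t)
    (ha : 0 < a) (hk : 1 ≤ k)
    (hexp : ∀ y : ℝ → E, (∀ t, 0 ≤ t → HasDerivWithinAt y (F (y t)) (Ici 0) t) →
      ∀ t, 0 ≤ t → ‖y t‖ ≤ k * Real.exp (-a * t) * ‖y 0‖)
    (hL : LipschitzOnWith L F (Metric.closedBall 0 (k * R))) (hη : 0 ≤ η) (hη1 : η ≤ 1)
    (hηk : η * k * Real.exp ((L + 1) * T₀) ≤ 1 / 4) {s t : ℝ} (hs : 0 ≤ s) (hst : s ≤ t)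
    (ht : t ≤ T) (hT₀ : t - s ≤ T₀) :
    ‖z t‖ ≤ (k * Real.exp (-a * (t - s)) + 1 / 4) * ‖z s‖ := by
  obtain ⟨y, hy0, hy⟩ := hex (z s)
  have hyb := hexp y hy
  rw [hy0] at hyb
  have hyc : ContinuousOn y (Ici 0) := fun t ht => (hy t ht).continuousWithinAt
  have hzs := h.norm_le s ⟨hs, hst.trans ht⟩
  have hR : 0 ≤ R := (norm_nonneg _).trans hzs
  have hyk : ∀ τ, 0 ≤ τ → ‖y τ‖ ≤ k * ‖z s‖ := fun τ hτ => by
    refine (hyb τ hτ).trans ?_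
    have : Real.exp (-a * τ) ≤ 1 := Real.exp_le_one_iff.2 (by nlinarith)
    have := mul_le_mul_of_nonneg_left this (by linarith : 0 ≤ k)
    rw [mul_one] at this
    gcongr
  set r := t - s with hr
  have hr0 : 0 ≤ r := by linarith
  have hzr : ContinuousOn (fun τ => z (s + τ)) (Icc 0 r) :=
    h.continuousOn.comp (by fun_prop) fun τ hτ => ⟨by linarith [hτ.1], by linarith [hτ.2]⟩
  have hyr : ContinuousOn y (Icc 0 r) := hyc.mono Icc_subset_Ici_self
  have hd : ContinuousOn (fun τ => ‖z (s + τ) - y τ‖) (Icc 0 r) := (hzr.sub hyr).norm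
  have key : ∀ x ∈ Icc 0 r, ‖z (s + x) - y x‖
      ≤ ∫ τ in (0 : ℝ)..x, ((L + 1) * ‖z (s + τ) - y τ‖ + η * (k * ‖z s‖)) := by
    intro x hx
    have hsub : uIcc 0 x ⊆ Icc 0 r := by
      rw [uIcc_of_le hx.1]
      exact Icc_subset_Icc_right hx.2
    have hzx := hzr.mono hsub
    have hyx := hyr.mono hsub
    have iz : IntervalIntegrable (fun τ => F (z (s + τ))) volume 0 x :=
      (hF.comp_continuousOn hzx).intervalIntegrable
    have iy : IntervalIntegrable (fun τ => F (y τ)) volume 0 x :=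
      (hF.comp_continuousOn hyx).intervalIntegrable
    have e1 : ∫ τ in (0 : ℝ)..x, F (y τ) = y x - z s := by
      rw [← hy0]
      refine intervalIntegral.integral_eq_sub_of_hasDeriv_right_of_le hx.1
        (hyr.mono (Icc_subset_Icc_right hx.2)) (fun τ hτ => ?_) iy
      exact (hy τ hτ.1.le).mono fun σ hσ => mem_Ici.2 (hτ.1.le.trans (mem_Ioi.1 hσ).le)
    have e2 : ∫ τ in s..(s + x), F (z τ) = ∫ τ in (0 : ℝ)..x, F (z (s + τ)) := by
      rw [intervalIntegral.integral_comp_add_left (fun τ => F (z τ)), add_zero]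
    have e3 : ∫ τ in s..(s + x), η * ‖z τ‖ = ∫ τ in (0 : ℝ)..x, η * ‖z (s + τ)‖ := by
      rw [intervalIntegral.integral_comp_add_left (fun τ => η * ‖z τ‖), add_zero]
    have h1 := h.close s (s + x) hs (by linarith [hx.1]) (by linarith [hx.2])
    rw [e2, e3] at h1
    have h2 : z (s + x) - y x = (z (s + x) - z s - ∫ τ in (0 : ℝ)..x, F (z (s + τ)))
        + ∫ τ in (0 : ℝ)..x, (F (z (s + τ)) - F (y τ)) := by
      rw [intervalIntegral.integral_sub iz iy, e1]
      abel
    have h3 := intervalIntegral.norm_integral_le_integral_norm (μ := volume) hx.1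
      (f := fun τ => F (z (s + τ)) - F (y τ))
    have i1 : IntervalIntegrable (fun τ => η * ‖z (s + τ)‖) volume 0 x :=
      (continuousOn_const.mul hzx.norm).intervalIntegrable
    have i2 := (iz.sub iy).norm
    rw [h2]
    refine (norm_add_le _ _).trans ((add_le_add h1 h3).trans ?_)
    rw [← intervalIntegral.integral_add i1 i2]
    refine intervalIntegral.integral_mono_on hx.1 (i1.add i2)
      ((continuousOn_const.mul (hzx.sub hyx).norm).add continuousOn_const).intervalIntegrable
      fun τ hτ => ?_
    have hτ0 := hτ.1
    have hz1 : ‖z (s + τ)‖ ≤ R := h.norm_le _ ⟨by linarith, by linarith [hτ.2, hx.2]⟩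
    have hLip := hL.norm_sub_le (x := z (s + τ)) (y := y τ)
      (by rw [mem_closedBall_zero_iff]; nlinarith)
      (by
        rw [mem_closedBall_zero_iff]
        exact (hyk τ hτ0).trans (mul_le_mul_of_nonneg_left hzs (by linarith)))
    have h4 : ‖z (s + τ)‖ ≤ ‖z (s + τ) - y τ‖ + k * ‖z s‖ := by
      have := norm_le_norm_add_norm_sub' (z (s + τ)) (y τ)
      linarith [hyk τ hτ0]
    have h5 := mul_le_mul_of_nonneg_left h4 hη
    have h6 := mul_le_mul_of_nonneg_right hη1 (norm_nonneg (z (s + τ) - y τ))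
    linarith
  have hL0 : (0 : ℝ) ≤ L := L.coe_nonneg
  have hg := le_exp_of_le_integral (by positivity) (by positivity) hd
    (fun _ _ => norm_nonneg _) key r ⟨hr0, le_rfl⟩
  have hzt : s + r = t := by rw [hr]; ring
  rw [hzt] at hg
  have h7 : η * (k * ‖z s‖) / (L + 1) * (Real.exp ((L + 1) * r) - 1) ≤ 1 / 4 * ‖z s‖ := by
    have h8 : η * (k * ‖z s‖) / (L + 1) ≤ η * (k * ‖z s‖) :=
      div_le_self (by positivity) (by linarith)
    have h9 : Real.exp ((L + 1) * r) ≤ Real.exp ((L + 1) * T₀) := by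
      gcongr
    have h10 : 0 ≤ Real.exp ((L + 1) * r) - 1 :=
      sub_nonneg.2 (Real.one_le_exp (by positivity))
    calc _ ≤ η * (k * ‖z s‖) * (Real.exp ((L + 1) * r) - 1) := by gcongr
      _ ≤ η * (k * ‖z s‖) * Real.exp ((L + 1) * T₀) := by gcongr; linarith
      _ = η * k * Real.exp ((L + 1) * T₀) * ‖z s‖ := by ring
      _ ≤ _ := by gcongr
  have := norm_le_norm_add_norm_sub' (z t) (y r)
  linarith [hyb r hr0]

/-- Perturbed solutions of relatively small perturbation inherit exponential decay. -/
theorem IsPerturbedSolution.norm_le_exp (h : IsPerturbedSolution F η R T z) (hF : Continuous F)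
    (hex : ∀ z₀, ∃ y : ℝ → E, y 0 = z₀ ∧ ∀ t, 0 ≤ t → HasDerivWithinAt y (F (y t)) (Ici 0) t)
    (ha : 0 < a) (hk : 1 ≤ k)
    (hexp : ∀ y : ℝ → E, (∀ t, 0 ≤ t → HasDerivWithinAt y (F (y t)) (Ici 0) t) →
      ∀ t, 0 ≤ t → ‖y t‖ ≤ k * Real.exp (-a * t) * ‖y 0‖)
    (hL : LipschitzOnWith L F (Metric.closedBall 0 (k * R))) (hη : 0 ≤ η) (hη1 : η ≤ 1)
    (hηk : η * k * Real.exp ((L + 1) * T₀) ≤ 1 / 4) (hT₀ : 0 < T₀)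
    (hkT : k * Real.exp (-a * T₀) ≤ 1 / 4) {t : ℝ} (ht : t ∈ Icc 0 T) :
    ‖z t‖ ≤ 2 * (k + 1) * Real.exp (-(Real.log 2 / T₀) * t) * ‖z 0‖ := by
  have step := fun {s t : ℝ} => h.norm_le_of_sub_le (s := s) (t := t) hF hex ha hk hexp hL hη hη1 hηk
  -- Each window of length `T₀` contributes a factor `1 / 4 + 1 / 4`, from the decay of the exact
  -- solution and from the deviation.
  have hN : ∀ N : ℕ, N * T₀ ≤ T → ‖z (N * T₀)‖ ≤ Real.exp (-Real.log 2 * N) * ‖z 0‖ := by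
    intro N
    induction N with
    | zero => simp
    | succ N ih =>
      intro hNT
      push_cast at hNT ⊢
      have h1 := ih (by nlinarith)
      have h2 := step (s := N * T₀) (t := (N + 1) * T₀) (by positivity) (by nlinarith) hNT
        (by linarith)
      have h3 : ((N : ℝ) + 1) * T₀ - N * T₀ = T₀ := by ring
      rw [h3] at h2
      have h4 : Real.exp (-Real.log 2 * (N + 1)) = 1 / 2 * Real.exp (-Real.log 2 * N) := by
        rw [mul_add, mul_one, Real.exp_add, Real.exp_neg, Real.exp_log two_pos]
        ring
      rw [h4]
      calc _ ≤ _ := h2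
        _ ≤ 1 / 2 * ‖z (N * T₀)‖ := by gcongr; linarith
        _ ≤ 1 / 2 * (Real.exp (-Real.log 2 * N) * ‖z 0‖) := by gcongr
        _ = _ := by ring
  set N := ⌊t / T₀⌋₊ with hNdef
  have h0 : 0 ≤ t / T₀ := div_nonneg ht.1 hT₀.le
  have hN1 : N * T₀ ≤ t := (le_div_iff₀ hT₀).1 (Nat.floor_le h0)
  have hN2 : t / T₀ < N + 1 := Nat.lt_floor_add_one _
  have hN3 : t < (N + 1) * T₀ := (div_lt_iff₀ hT₀).1 hN2
  have h1 := hN N (hN1.trans ht.2)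
  have h2 := step (s := N * T₀) (t := t) (by positivity) hN1 ht.2 (by linarith)
  have h3 : k * Real.exp (-a * (t - N * T₀)) ≤ k := by
    have : Real.exp (-a * (t - N * T₀)) ≤ 1 := Real.exp_le_one_iff.2 (by nlinarith)
    nlinarith
  -- Rounding `t / T₀` down loses at most one halving, hence the factor `2`.
  have h4 : Real.exp (-Real.log 2 * N) ≤ 2 * Real.exp (-(Real.log 2 / T₀) * t) := by
    have h5 : (2 : ℝ) * Real.exp (-(Real.log 2 / T₀) * t)
        = Real.exp (Real.log 2 + -(Real.log 2 / T₀) * t) := by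
      rw [Real.exp_add, Real.exp_log two_pos]
    rw [h5]
    refine Real.exp_le_exp.2 ?_
    have h6 : Real.log 2 / T₀ * t = Real.log 2 * (t / T₀) := by ring
    have h7 := Real.log_pos one_lt_two
    nlinarith
  calc _ ≤ _ := h2
    _ ≤ (k + 1) * ‖z (N * T₀)‖ := by gcongr; linarith
    _ ≤ (k + 1) * (2 * Real.exp (-(Real.log 2 / T₀) * t) * ‖z 0‖) := by
        gcongr
        exact h1.trans (by gcongr)
    _ = _ := by ring

end Decay

/-! ### Sliding motions -/

variable {n m l : ℕ} {f : XVec n m → Vec n} {X : Set (Vec n)} {U : Set (Vec m)}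
  {p : PWAModel f X U l} {c : Gains n m l} {Sx : Vec n →L[ℝ] Vec m} {Su : Vec m ≃L[ℝ] Vec m}
  {γ T : ℝ} {z : ℝ → XVec n m} {w : ℝ → Fin (l + 1) → ℝ}

/-- The field of the sliding motion in the cell `i`. -/
def slidingField (p : PWAModel f X U l) (c : Gains n m l) (Sx : Vec n →L[ℝ] Vec m)
    (Su : Vec m ≃L[ℝ] Vec m) (i : Fin (l + 1)) (x : XVec n m) : XVec n m :=
  joinVec (f x) (c.law i x - Su.symm (mismatch p Sx i x))

lemma continuous_slidingField (hf : Continuous f) (p : PWAModel f X U l) (c : Gains n m l)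
    (Sx : Vec n →L[ℝ] Vec m) (Su : Vec m ≃L[ℝ] Vec m) (i : Fin (l + 1)) :
    Continuous (slidingField p c Sx Su i) :=
  continuous_joinVec.comp (hf.prodMk ((c.continuous_law i).sub
    (Su.symm.continuous.comp (continuous_mismatch hf p Sx i))))

lemma st_sum_slidingField {a : Fin (l + 1) → ℝ} (ha : ∑ i, a i = 1) (x : XVec n m) :
    st (∑ i, a i • slidingField p c Sx Su i x) = f x := by
  rw [← stL_apply, map_sum]
  simp only [map_smul, stL_apply, slidingField, st_joinVec]
  rw [← Finset.sum_smul, ha, one_smul]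

lemma inp_sum_slidingField (a : Fin (l + 1) → ℝ) (x : XVec n m) :
    inp (∑ i, a i • slidingField p c Sx Su i x)
      = ∑ i, a i • (c.law i x - Su.symm (Sx (f x - p.nominal i x))) := by
  rw [← inpL_apply, map_sum]
  simp only [map_smul, inpL_apply, slidingField, inp_joinVec, mismatch]

lemma integrableOn_slidingField (hf : Continuous f) (hz : ContinuousOn z (Icc 0 T))
    (hw : IsCellWeight p T z w) :
    IntegrableOn (fun τ => ∑ i, w τ i • slidingField p c Sx Su i (z τ)) (Icc 0 T) :=
  hw.integrableOn_sum fun i => integrableOn_comp_Icc (continuous_slidingField hf p c Sx Su i) hz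

/-- Merging plant and input into one integral equation gives the form used by the Filippov existence
theorem and by the perturbation estimate. The plant carries no weights, which is consistent because
they sum to one. -/
lemma isSlidingMotion_iff (hf : Continuous f) :
    IsSlidingMotion p c Sx Su T z w ↔ ContinuousOn z (Icc 0 T) ∧ (∀ t ∈ Icc 0 T, z t ∈ rect X U) ∧
      IsCellWeight p T z w ∧ ∀ t ∈ Icc 0 T,
        z t = z 0 + ∫ τ in (0 : ℝ)..t, ∑ i, w τ i • slidingField p c Sx Su i (z τ) := by
  have key : ContinuousOn z (Icc 0 T) → IsCellWeight p T z w → ∀ t ∈ Icc 0 T,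
      st (∫ τ in (0 : ℝ)..t, ∑ i, w τ i • slidingField p c Sx Su i (z τ))
        = ∫ τ in (0 : ℝ)..t, f (z τ) ∧
      inp (∫ τ in (0 : ℝ)..t, ∑ i, w τ i • slidingField p c Sx Su i (z τ))
        = ∫ τ in (0 : ℝ)..t,
          ∑ i, w τ i • (c.law i (z τ) - Su.symm (Sx (f (z τ) - p.nominal i (z τ)))) := by
    intro hz hw t ht
    have h0 : (0 : ℝ) ∈ Icc 0 T := ⟨le_rfl, ht.1.trans ht.2⟩
    have hI := intervalIntegrable_of_integrableOn_Icc
      (integrableOn_slidingField (c := c) (Sx := Sx) (Su := Su) hf hz hw) h0 ht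
    rw [← stL_apply, ← inpL_apply, ← stL.intervalIntegral_comp_comm hI,
      ← inpL.intervalIntegral_comp_comm hI]
    simp only [stL_apply, inpL_apply, inp_sum_slidingField, and_true]
    refine integral_congr_ae_Icc ?_ h0 ht
    filter_upwards [hw.sum_eq_one] with τ hτ using st_sum_slidingField hτ _
  constructor
  · intro h
    refine ⟨h.continuousOn, h.mem, h.weight, fun t ht => ?_⟩
    obtain ⟨h1, h2⟩ := key h.continuousOn h.weight t ht
    refine ext_st_inp ?_ ?_
    · rw [h.plant t ht, ← h1, ← stL_apply, ← stL_apply, ← stL_apply, ← map_add]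
    · rw [h.control t ht, ← h2, ← inpL_apply, ← inpL_apply, ← inpL_apply, ← map_add]
  · rintro ⟨hz, hm, hw, h⟩
    refine ⟨hz, hm, hw, fun t ht => ?_, fun t ht => ?_⟩
    · rw [← (key hz hw t ht).1, h t ht, ← stL_apply, map_add]
      rfl
    · rw [← (key hz hw t ht).2, h t ht, ← inpL_apply, map_add]
      rfl

lemma IsSlidingMotion.mono (h : IsSlidingMotion p c Sx Su T z w) {t : ℝ} (ht : t ≤ T) :
    IsSlidingMotion p c Sx Su t z w :=
  have hs : Icc (0 : ℝ) t ⊆ Icc 0 T := Icc_subset_Icc_right ht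
  ⟨h.continuousOn.mono hs, fun s h1 => h.mem s (hs h1), h.weight.mono ht,
    fun s h1 => h.plant s (hs h1), fun s h1 => h.control s (hs h1)⟩

/-- Sliding motions solve the stabilized system up to a perturbation that is as small as the gains
are accurate. -/
lemma IsSlidingMotion.isPerturbedSolution (h : IsSlidingMotion p c Sx Su T z w)
    (hf : Continuous f) {g : XVec n m → Vec m} (hg : Continuous g) {η R : ℝ}
    (hR : ∀ x ∈ rect X U, ‖x‖ ≤ R)
    (hη : ∀ i, ∀ x ∈ p.cell i, ‖c.law i x - Su.symm (mismatch p Sx i x) - g x‖ ≤ η * ‖x‖) :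
    IsPerturbedSolution (closedLoopField f g) η R T z := by
  refine ⟨h.continuousOn, fun t ht => hR _ (h.mem t ht), fun s t hs hst ht => ?_⟩
  obtain ⟨hz, -, hw, heq⟩ := (isSlidingMotion_iff hf).1 h
  have hF : Continuous (closedLoopField f g) := continuous_joinVec.comp (hf.prodMk hg)
  have hs' : s ∈ Icc 0 T := ⟨hs, hst.trans ht⟩
  have ht' : t ∈ Icc 0 T := ⟨hs.trans hst, ht⟩
  have h0 : (0 : ℝ) ∈ Icc 0 T := ⟨le_rfl, hs.trans (hst.trans ht)⟩
  have hG := integrableOn_slidingField (c := c) (Sx := Sx) (Su := Su) hf hz hw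
  have hFI := integrableOn_comp_Icc hF hz
  have e1 : z t - z s = ∫ τ in s..t, ∑ i, w τ i • slidingField p c Sx Su i (z τ) := by
    rw [heq t ht', heq s hs', add_sub_add_left_eq_sub, intervalIntegral.integral_interval_sub_left
      (intervalIntegrable_of_integrableOn_Icc hG h0 ht')
      (intervalIntegrable_of_integrableOn_Icc hG h0 hs')]
  rw [e1, ← intervalIntegral.integral_sub (intervalIntegrable_of_integrableOn_Icc hG hs' ht')
    (intervalIntegrable_of_integrableOn_Icc hFI hs' ht')]
  refine intervalIntegral.norm_integral_le_of_norm_le hst ?_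
    (intervalIntegrable_of_integrableOn_Icc
      (integrableOn_comp_Icc (φ := fun x => η * ‖x‖) (by fun_prop) hz) hs' ht')
  have hae : ∀ᵐ τ ∂volume.restrict (Icc 0 T),
      ‖∑ i, w τ i • slidingField p c Sx Su i (z τ) - closedLoopField f g (z τ)‖ ≤ η * ‖z τ‖ := by
    filter_upwards [hw.nonneg, hw.sum_eq_one, hw.support] with τ h1 h2 h3
    have e2 : ∑ i, w τ i • slidingField p c Sx Su i (z τ) - closedLoopField f g (z τ)
        = ∑ i, w τ i • (slidingField p c Sx Su i (z τ) - closedLoopField f g (z τ)) := by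
      simp only [smul_sub, Finset.sum_sub_distrib]
      rw [← Finset.sum_smul, h2, one_smul]
    have e3 : η * ‖z τ‖ = ∑ i, w τ i * (η * ‖z τ‖) := by rw [← Finset.sum_mul, h2, one_mul]
    rw [e2, e3]
    refine (norm_sum_le _ _).trans (Finset.sum_le_sum fun i _ => ?_)
    rw [norm_smul, Real.norm_of_nonneg (h1 i)]
    by_cases hi : w τ i = 0
    · simp [hi]
    refine mul_le_mul_of_nonneg_left ?_ (h1 i)
    -- The state components agree exactly, so only the error of the input law remains.
    rw [slidingField, closedLoopField, joinVec_sub, sub_self, norm_joinVec_zero]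
    exact hη i _ (h3 i hi)
  rw [ae_restrict_iff' measurableSet_Icc] at hae
  filter_upwards [hae] with τ h1 h2
  exact h1 ⟨hs.trans h2.1.le, h2.2.trans ht⟩

end ISMPC

namespace ISMPC

/-! ### Continuation of sliding motions -/

/-- The radial retraction onto the closed ball of radius `ρ`. -/
def radialRetract {E : Type*} [NormedAddCommGroup E] [NormedSpace ℝ E] (ρ : ℝ) (x : E) : E :=
  (ρ / max ρ ‖x‖) • x

section Retract

variable {E : Type*} [NormedAddCommGroup E] [NormedSpace ℝ E] {ρ : ℝ}

lemma continuous_radialRetract (hρ : 0 < ρ) : Continuous (radialRetract ρ : E → E) :=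
  (continuous_const.div (continuous_const.max continuous_norm)
    fun _ => (lt_max_of_lt_left hρ).ne').smul continuous_id

lemma norm_radialRetract_le (hρ : 0 < ρ) (x : E) : ‖radialRetract ρ x‖ ≤ ρ := by
  have h : 0 < max ρ ‖x‖ := lt_max_of_lt_left hρ
  rw [radialRetract, norm_smul, Real.norm_of_nonneg (by positivity), div_mul_eq_mul_div,
    div_le_iff₀ h]
  gcongr
  exact le_max_right _ _

lemma radialRetract_of_norm_le (hρ : 0 < ρ) {x : E} (hx : ‖x‖ ≤ ρ) : radialRetract ρ x = x := by
  rw [radialRetract, max_eq_left hx, div_self hρ.ne', one_smul]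

end Retract

variable {n m l : ℕ} {f : XVec n m → Vec n} {X : Set (Vec n)} {U : Set (Vec m)}
  {p : PWAModel f X U l} {c : Gains n m l} {Sx : Vec n →L[ℝ] Vec m} {Su : Vec m ≃L[ℝ] Vec m}
  {γ T : ℝ} {z : ℝ → XVec n m} {w : ℝ → Fin (l + 1) → ℝ}

/-- The equilibrium at the origin is a sliding motion. -/
lemma isSlidingMotion_zero (hf : Continuous f) (hf0 : f 0 = 0) (h0 : 0 ∈ rect X U) (T : ℝ) :
    IsSlidingMotion p c Sx Su T (fun _ => 0) (fun _ => Pi.single 0 1) := by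
  have hfield : slidingField p c Sx Su 0 0 = 0 := by
    simp only [slidingField, mismatch, PWAModel.nominal, Gains.law, hf0, p.C_zero, c.D_zero]
    rw [← stL_apply, ← inpL_apply]
    simp only [map_zero, add_zero, sub_zero]
    exact joinL.map_zero
  refine (isSlidingMotion_iff hf).2 ⟨continuousOn_const, fun _ _ => h0,
    ⟨fun i => measurable_const, ae_of_all _ fun t i => ?_, ae_of_all _ fun t => ?_,
      ae_of_all _ fun t i hi => ?_⟩, fun t _ => ?_⟩
  · by_cases h : i = 0
    · subst h; simp
    · simp [h]
  · simp
  · have hi0 : i = 0 := by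
      by_contra h
      exact hi (by simp [h])
    subst hi0
    have := (p.origin 0).2 rfl
    exact ⟨⟨h0.1, this.1⟩, h0.2, this.2⟩
  · have : ∑ i, (Pi.single (M := fun _ : Fin (l + 1) => ℝ) 0 1 i) • slidingField p c Sx Su i 0
        = 0 := by
      rw [Finset.sum_eq_single 0 (fun i _ hi => by simp [hi]) (by simp), hfield, smul_zero]
    simp [this]

/-- A sliding motion that is followed by a Filippov solution in the ball of radius `ρ`. -/
lemma isSlidingMotion_concat (hf : Continuous f) (hT : 0 ≤ T)
    (h : IsSlidingMotion p c Sx Su T z w) {ρ : ℝ} (hρ : 0 < ρ)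
    (hball : Metric.closedBall 0 ρ ⊆ rect X U) {y : ℝ → XVec n m} {ω : ℝ → Fin (l + 1) → ℝ}
    (hyT : y T = z T) (hyc : Continuous y) (hωm : ∀ i, Measurable fun t => ω t i)
    (hω : ∀ᵐ t, T ≤ t → (∀ i, 0 ≤ ω t i) ∧ ∑ i, ω t i = 1 ∧
      ∀ i, ω t i ≠ 0 → radialRetract ρ (y t) ∈ p.cell i)
    (hy : ∀ t, T ≤ t → y t = z T + ∫ τ in T..t,
      ∑ i, ω τ i • slidingField p c Sx Su i (radialRetract ρ (y τ)))
    {T' : ℝ} (hTT' : T ≤ T') (hyρ : ∀ t ∈ Icc T T', ‖y t‖ ≤ ρ) :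
    IsSlidingMotion p c Sx Su T' (fun t => if t ≤ T then z t else y t)
      (fun t => if t ≤ T then w t else ω t) := by
  obtain ⟨hz, hm, hw, heq⟩ := (isSlidingMotion_iff hf).1 h
  set z' : ℝ → XVec n m := fun t => if t ≤ T then z t else y t with hz'
  set w' : ℝ → Fin (l + 1) → ℝ := fun t => if t ≤ T then w t else ω t with hw'
  have hz1 : EqOn z' z (Icc 0 T) := fun t ht => if_pos ht.2
  have hz2 : EqOn z' y (Ici T) := fun t ht => by
    rcases eq_or_lt_of_le (mem_Ici.1 ht) with rfl | hlt
    · simp [hz', hyT]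
    · exact if_neg (not_le.2 hlt)
  have hz0 : z' 0 = z 0 := hz1 ⟨le_rfl, hT⟩
  have hcont : ContinuousOn z' (Icc 0 T') := by
    rw [← Icc_union_Icc_eq_Icc hT hTT']
    exact (hz.congr hz1).union_of_isClosed
      (hyc.continuousOn.congr (hz2.mono Icc_subset_Ici_self)) isClosed_Icc isClosed_Icc
  have hw1 := hw.nonneg
  have hw2 := hw.sum_eq_one
  have hw3 := hw.support
  rw [ae_restrict_iff' measurableSet_Icc] at hw1 hw2 hw3
  have hweight : IsCellWeight p T' z' w' := by
    refine ⟨fun i => ?_, ?_, ?_, ?_⟩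
    · have : (fun t => w' t i) = fun t => if t ≤ T then w t i else ω t i := by
        ext t
        simp only [hw']
        split_ifs <;> rfl
      rw [this]
      exact Measurable.ite measurableSet_Iic (hw.measurable i) (hωm i)
    all_goals
      rw [ae_restrict_iff' measurableSet_Icc]
      filter_upwards [hw1, hw2, hw3, hω] with t h1 h2 h3 h4 ht
      simp only [hw', hz']
      split_ifs with htT
    · exact h1 ⟨ht.1, htT⟩
    · exact (h4 (not_le.1 htT).le).1
    · exact h2 ⟨ht.1, htT⟩
    · exact (h4 (not_le.1 htT).le).2.1
    · exact h3 ⟨ht.1, htT⟩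
    · intro i hi
      have := (h4 (not_le.1 htT).le).2.2 i hi
      rwa [radialRetract_of_norm_le hρ (hyρ t ⟨(not_le.1 htT).le, ht.2⟩)] at this
  have hcongr1 : ∀ t ∈ Icc 0 T, ∫ τ in (0 : ℝ)..t, ∑ i, w' τ i • slidingField p c Sx Su i (z' τ)
      = ∫ τ in (0 : ℝ)..t, ∑ i, w τ i • slidingField p c Sx Su i (z τ) := fun t ht => by
    refine intervalIntegral.integral_congr fun τ hτ => ?_
    rw [uIcc_of_le ht.1] at hτ
    have hτT : τ ≤ T := hτ.2.trans ht.2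
    simp only [hw', hz', if_pos hτT]
  refine (isSlidingMotion_iff hf).2 ⟨hcont, fun t ht => ?_, hweight, fun t ht => ?_⟩
  · rcases le_total t T with htT | htT
    · rw [hz1 ⟨ht.1, htT⟩]
      exact hm t ⟨ht.1, htT⟩
    · rw [hz2 htT]
      exact hball (mem_closedBall_zero_iff.2 (hyρ t ⟨htT, ht.2⟩))
  · rcases le_total t T with htT | htT
    · rw [hcongr1 t ⟨ht.1, htT⟩, hz1 ⟨ht.1, htT⟩, hz0]
      exact heq t ⟨ht.1, htT⟩
    · have hint := integrableOn_slidingField (c := c) (Sx := Sx) (Su := Su) hf hcont hweight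
      have m0 : (0 : ℝ) ∈ Icc 0 T' := ⟨le_rfl, hT.trans hTT'⟩
      have mT : T ∈ Icc 0 T' := ⟨hT, hTT'⟩
      rw [← intervalIntegral.integral_add_adjacent_intervals
        (intervalIntegrable_of_integrableOn_Icc hint m0 mT)
        (intervalIntegrable_of_integrableOn_Icc hint mT ht), hcongr1 T ⟨hT, le_rfl⟩, ← add_assoc,
        hz0, ← heq T ⟨hT, le_rfl⟩, hz2 htT, hy t htT]
      congr 1
      -- The half-open interval leaves out `T`, where the glued weight is still `w`.
      refine intervalIntegral.integral_congr_ae (ae_of_all _ fun τ hτ => ?_)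
      rw [uIoc_of_le htT] at hτ
      have h1 : z' τ = y τ := hz2 (mem_Ici.2 hτ.1.le)
      have h2 : w' τ = ω τ := if_neg (not_le.2 hτ.1)
      rw [h1, h2, radialRetract_of_norm_le hρ (hyρ τ ⟨hτ.1.le, hτ.2.trans ht.2⟩)]

/-- Sliding motions that are a priori bounded by `M ‖z 0‖`, where a larger ball lies inside the
region, continue for all times. -/
theorem IsSlidingMotion.exists_extension (hf : Continuous f) (hf0 : f 0 = 0) (hX : IsClosed X)
    (hU : IsClosed U) {M M' : ℝ} (hM : 0 ≤ M) (hMM' : M < M')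
    (hbound : ∀ T z w, 0 ≤ T → IsSlidingMotion p c Sx Su T z w →
      ∀ t ∈ Icc 0 T, ‖z t‖ ≤ M * ‖z 0‖)
    (hT : 0 ≤ T) (h : IsSlidingMotion p c Sx Su T z w)
    (hball : Metric.closedBall 0 (M' * ‖z 0‖) ⊆ rect X U) :
    ∃ z' w', EqOn z' z (Icc 0 T) ∧ ∀ T', 0 ≤ T' → IsSlidingMotion p c Sx Su T' z' w' := by
  have hM' : 0 < M' := hM.trans_lt hMM'
  -- From the origin the radius `ρ` would be zero; there the a priori bound forces `z = 0`, and the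
  -- equilibrium continues it.
  by_cases hz0 : z 0 = 0
  · refine ⟨fun _ => 0, fun _ => Pi.single 0 1, fun t ht => ?_, fun T' _ =>
      isSlidingMotion_zero hf hf0 (hball (by simp [hz0])) T'⟩
    have := hbound T z w hT h t ht
    rw [hz0, norm_zero, mul_zero] at this
    exact (norm_le_zero_iff.1 this).symm
  have hz0' : 0 < ‖z 0‖ := norm_pos_iff.2 hz0
  set ρ := M' * ‖z 0‖ with hρdef
  have hρ : 0 < ρ := mul_pos hM' hz0'
  have hMρ : M * ‖z 0‖ < ρ := mul_lt_mul_of_pos_right hMM' hz0'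
  have hC : ∃ C, ∀ i x, ‖slidingField p c Sx Su i (radialRetract ρ x)‖ ≤ C := by
    have h1 := fun i => (isCompact_closedBall (0 : XVec n m) ρ).exists_bound_of_continuousOn
      (continuous_slidingField hf p c Sx Su i).continuousOn
    choose B hB using h1
    refine ⟨∑ i, |B i|, fun i x => ?_⟩
    refine (hB i _ (mem_closedBall_zero_iff.2 (norm_radialRetract_le hρ x))).trans
      ((le_abs_self _).trans ?_)
    exact Finset.single_le_sum (f := fun i => |B i|) (fun j _ => abs_nonneg _) (Finset.mem_univ i)
  obtain ⟨C, hC⟩ := hC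
  obtain ⟨y, ω, hyT, hyc, hωm, hω, hy⟩ := exists_filippov_solution
    (H := fun i x => slidingField p c Sx Su i (radialRetract ρ x))
    (fun i => (continuous_slidingField hf p c Sx Su i).comp (continuous_radialRetract hρ)) hC
    (S := fun i => radialRetract ρ ⁻¹' p.cell i)
    (fun i => (p.isClosed_cell hX hU i).preimage (continuous_radialRetract hρ))
    (fun x => p.exists_mem_cell
      (hball (mem_closedBall_zero_iff.2 (norm_radialRetract_le hρ x)))) T (z T)
  have hconcat := fun {T' : ℝ} => isSlidingMotion_concat (T' := T') hf hT h hρ hball hyT hyc hωm hω hy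
  -- Bootstrap: up to the first time `t₂` with `‖y‖ ≥ ρ` the glued curve is a genuine sliding
  -- motion, so its norm is at most `M * ‖z 0‖ < ρ` at `t₂`, a contradiction.
  have hin : ∀ t, T ≤ t → ‖y t‖ ≤ ρ := by
    by_contra! hcon
    obtain ⟨t₁, ht₁, hyt₁⟩ := hcon
    have hK : IsCompact (Icc T t₁ ∩ {t | ρ ≤ ‖y t‖}) :=
      isCompact_Icc.inter_right (isClosed_le continuous_const hyc.norm)
    obtain ⟨t₂, ⟨ht₂, hyt₂⟩, hmin⟩ := hK.exists_isLeast ⟨t₁, ⟨ht₁, le_rfl⟩, hyt₁.le⟩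
    have hyT' : ‖y T‖ < ρ := by
      rw [hyT]
      exact (hbound T z w hT h T ⟨hT, le_rfl⟩).trans_lt hMρ
    have hTt₂ : T < t₂ := by
      refine lt_of_le_of_ne ht₂.1 ?_
      rintro rfl
      exact absurd hyT' (not_lt.2 hyt₂)
    have hlt : ∀ t ∈ Ico T t₂, ‖y t‖ ≤ ρ := fun t ht => by
      by_contra! hcon
      exact absurd (hmin ⟨⟨ht.1, ht.2.le.trans ht₂.2⟩, hcon.le⟩) (not_le.2 ht.2)
    have hle : ∀ t ∈ Icc T t₂, ‖y t‖ ≤ ρ := fun t ht => by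
      have hcl : t ∈ closure (Ico T t₂) := by rwa [closure_Ico hTt₂.ne]
      exact closure_minimal (t := {t | ‖y t‖ ≤ ρ}) hlt
        (isClosed_le hyc.norm continuous_const) hcl
    have := hbound t₂ _ _ (hT.trans ht₂.1) (hconcat ht₂.1 hle) t₂ ⟨hT.trans ht₂.1, le_rfl⟩
    simp only [if_neg (not_le.2 hTt₂), if_pos hT] at this
    exact absurd (this.trans_lt hMρ) (not_lt.2 hyt₂)
  refine ⟨_, _, fun t ht => ?_, fun T' _ =>
    (hconcat (le_max_left T T') fun t ht => hin t ht.1).mono (le_max_right T T')⟩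
  exact if_pos ht.2

end ISMPC

namespace ISMPC

/-! ### Grids of boxes -/

/-- A finite family of boxes `∏ [A i k, B i k]` with disjoint interiors that covers the cube of
radius `R`: the box `0` is the cube of radius `r`, the other ones lie outside and are `δ`-small. -/
theorem exists_grid (κ : Type*) [Fintype κ] {r δ R : ℝ} (hr : 0 < r) (hδ : 0 < δ) :
    ∃ (l : ℕ) (A B ctr : Fin (l + 1) → κ → ℝ), (∀ i k, A i k < B i k) ∧
      (∀ x : κ → ℝ, (∀ k, |x k| ≤ R) → ∃ i, ∀ k, A i k ≤ x k ∧ x k ≤ B i k) ∧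
      (∀ i j, i ≠ j → ∃ k, B i k ≤ A j k ∨ B j k ≤ A i k) ∧
      (∀ k, A 0 k = -r ∧ B 0 k = r) ∧
      ∀ i, i ≠ 0 → ∀ x : κ → ℝ, (∀ k, A i k ≤ x k ∧ x k ≤ B i k) →
        (∃ k, r ≤ |x k|) ∧ ∀ k, |x k - ctr i k| ≤ δ := by
  classical
  obtain ⟨q, hq⟩ := exists_nat_ge (r / δ)
  -- With cells of side `h` centred at the points of `h ℤ^κ`, the identity `h * (q + 1 / 2) = r`
  -- makes the central cube an exact union of cells. These are merged into the box `0`, and `J`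
  -- collects the centres of the others.
  set h : ℝ := r / (q + 1 / 2) with hh
  have hq0 : (0 : ℝ) < q + 1 / 2 := by positivity
  have hh0 : 0 < h := by positivity
  have hhr : h * (q + 1 / 2) = r := by rw [hh]; field_simp
  have hhδ : h / 2 ≤ δ := by
    have h1 : r ≤ q * δ := (div_le_iff₀ hδ).1 hq
    have h2 : h ≤ δ := by
      rw [hh, div_le_iff₀ hq0]
      nlinarith
    linarith
  set N : ℤ := ⌈R / h⌉ + 1 with hN
  set J : Finset (κ → ℤ) :=
    (Fintype.piFinset fun _ => Finset.Icc (-N) N).filter fun a => ∃ k, (q : ℤ) < |a k| with hJ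
  let e : J ≃ Fin J.card := J.equivFin
  have hmem : ∀ j, ∃ k, (q : ℤ) < |(e.symm j : κ → ℤ) k| := fun j =>
    (Finset.mem_filter.1 (e.symm j).2).2
  have hfar : ∀ {a : ℤ}, (q : ℤ) < |a| → r ≤ h * (a - 1 / 2) ∨ h * (a + 1 / 2) ≤ -r := by
    intro a ha
    have h1 : ((q : ℤ) : ℝ) + 1 ≤ ((|a| : ℤ) : ℝ) := by exact_mod_cast ha
    push_cast at h1
    rw [← hhr]
    rcases le_total 0 (a : ℝ) with h2 | h2
    · rw [abs_of_nonneg h2] at h1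
      left
      gcongr
      linarith
    · rw [abs_of_nonpos h2] at h1
      right
      nlinarith
  have hsep : ∀ {a b : ℤ}, a < b → h * ((a : ℝ) + 1 / 2) ≤ h * (b - 1 / 2) := by
    intro a b hab
    have : (a : ℝ) + 1 ≤ b := by exact_mod_cast hab
    gcongr
    linarith
  refine ⟨J.card, Fin.cons (fun _ => -r) fun j k => h * ((e.symm j : κ → ℤ) k - 1 / 2),
    Fin.cons (fun _ => r) fun j k => h * ((e.symm j : κ → ℤ) k + 1 / 2),
    Fin.cons (fun _ => 0) fun j k => h * (e.symm j : κ → ℤ) k, ?_, ?_, ?_, ?_, ?_⟩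
  · intro i k
    induction i using Fin.cases with
    | zero => simpa using by linarith
    | succ j =>
      simp only [Fin.cons_succ]
      gcongr
      linarith
  · intro x hx
    by_cases hin : ∀ k, |x k| ≤ r
    · exact ⟨0, fun k => abs_le.1 (hin k)⟩
    push Not at hin
    obtain ⟨k₀, hk₀⟩ := hin
    have hround : ∀ k, |x k / h - round (x k / h)| ≤ 1 / 2 := fun k => abs_sub_round _
    have hJm : (fun k => round (x k / h)) ∈ J := by
      refine Finset.mem_filter.2 ⟨Fintype.mem_piFinset.2 fun k => Finset.mem_Icc.2 ?_, k₀, ?_⟩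
      · have h1 : |x k / h| ≤ R / h := by
          rw [abs_div, abs_of_pos hh0]
          gcongr
          exact hx k
        have h2 := Int.le_ceil (R / h)
        have h3 := abs_le.1 (hround k)
        have h4 := abs_le.1 h1
        constructor
        · have : ((-N : ℤ) : ℝ) ≤ (round (x k / h) : ℤ) := by
            rw [hN]; push_cast; linarith
          exact_mod_cast this
        · have : ((round (x k / h) : ℤ) : ℝ) ≤ (N : ℤ) := by
            rw [hN]; push_cast; linarith
          exact_mod_cast this
      · have h1 : (q : ℝ) + 1 / 2 < |x k₀ / h| := by
          rw [abs_div, abs_of_pos hh0, lt_div_iff₀ hh0]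
          linarith
        have h2 := abs_sub_abs_le_abs_sub (x k₀ / h) (round (x k₀ / h))
        have h3 : ((q : ℤ) : ℝ) < ((|round (x k₀ / h)| : ℤ) : ℝ) := by
          push_cast
          linarith [hround k₀]
        exact_mod_cast h3
    refine ⟨Fin.succ (e ⟨_, hJm⟩), fun k => ?_⟩
    simp only [Fin.cons_succ, Equiv.symm_apply_apply]
    have h3 := abs_le.1 (hround k)
    have h4 : x k = h * (x k / h) := by field_simp
    constructor
    · rw [h4, ← h4]
      calc _ ≤ h * (x k / h) := by gcongr; linarith
        _ = _ := h4.symm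
    · calc x k = _ := h4
        _ ≤ _ := by gcongr; linarith
  · intro i j hij
    have hcb : ∀ j', ∃ k, r ≤ h * ((e.symm j' : κ → ℤ) k - 1 / 2) ∨
        h * ((e.symm j' : κ → ℤ) k + 1 / 2) ≤ -r := fun j' => by
      obtain ⟨k, hk⟩ := hmem j'
      exact ⟨k, hfar hk⟩
    induction i using Fin.cases with
    | zero =>
      induction j using Fin.cases with
      | zero => exact absurd rfl hij
      | succ j => simpa only [Fin.cons_succ, Fin.cons_zero] using hcb j
    | succ i =>
      induction j using Fin.cases with
      | zero => simpa only [Fin.cons_succ, Fin.cons_zero, or_comm] using hcb i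
      | succ j =>
        simp only [Fin.cons_succ]
        have hne : (e.symm i : κ → ℤ) ≠ e.symm j := fun h =>
          hij (congrArg Fin.succ (e.symm.injective (Subtype.ext h)))
        obtain ⟨k, hk⟩ := Function.ne_iff.1 hne
        exact ⟨k, (lt_or_gt_of_ne hk).imp hsep hsep⟩
  · intro k
    simp
  · intro i hi x hx
    induction i using Fin.cases with
    | zero => exact absurd rfl hi
    | succ j =>
      simp only [Fin.cons_succ] at hx ⊢
      constructor
      · obtain ⟨k, hk⟩ := hmem j
        refine ⟨k, ?_⟩
        rcases hfar hk with h1 | h1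
        · exact (h1.trans (hx k).1).trans (le_abs_self _)
        · linarith [neg_abs_le (x k), (hx k).2]
      · intro k
        rw [abs_le]
        constructor <;> linarith [(hx k).1, (hx k).2]

/-! ### Boxes as cells of the product space. -/

/-- The box `∏ [a i, b i]`. -/
def box {n : ℕ} (a b : Fin n → ℝ) : Set (Vec n) := {x | ∀ i, a i ≤ x i ∧ x i ≤ b i}

lemma isPolyhedron_box {n : ℕ} (a b : Fin n → ℝ) : IsPolyhedron (box a b) := by
  refine ⟨n + n, fun j => Sum.elim (fun i => -EuclideanSpace.single i (1 : ℝ))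
    (fun i => EuclideanSpace.single i (1 : ℝ)) (finSumFinEquiv.symm j),
    fun j => Sum.elim (fun i => -a i) b (finSumFinEquiv.symm j), ?_⟩
  ext x
  simp only [box, mem_ofPred_eq]
  rw [finSumFinEquiv.symm.forall_congr_left]
  simp [Sum.forall, forall_and, inner_neg_left, EuclideanSpace.inner_single_left]

lemma interior_box_nonempty {n : ℕ} {a b : Fin n → ℝ} (hab : ∀ i, a i < b i) :
    (interior (box a b)).Nonempty := by
  refine ⟨WithLp.toLp 2 fun i => (a i + b i) / 2, ?_⟩
  refine interior_maximal (s := box a b)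
    (t := ⋂ i, {x : Vec n | a i < x i} ∩ {x : Vec n | x i < b i}) (fun x hx i => ?_)
    (isOpen_iInter_of_finite fun i => (isOpen_lt (by fun_prop) (by fun_prop)).inter
      (isOpen_lt (by fun_prop) (by fun_prop))) (mem_iInter.2 fun i => ⟨?_, ?_⟩)
  · have := mem_iInter.1 hx i
    exact ⟨le_of_lt this.1, le_of_lt this.2⟩
  · simp only [mem_ofPred_eq]
    linarith [hab i]
  · simp only [mem_ofPred_eq]
    linarith [hab i]

section

variable {n m : ℕ}

lemma mem_rect_box {A B : Fin n ⊕ Fin m → ℝ} {z : XVec n m} :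
    z ∈ rect (box (A ∘ Sum.inl) (B ∘ Sum.inl)) (box (A ∘ Sum.inr) (B ∘ Sum.inr))
      ↔ ∀ k, A k ≤ z k ∧ z k ≤ B k :=
  ⟨fun h k => k.casesOn h.1 h.2, fun h => ⟨fun i => h (Sum.inl i), fun i => h (Sum.inr i)⟩⟩

/-- Coordinate projections are open maps, so they send the interior of the box into the open
interval. -/
lemma lt_of_mem_interior_rect_box {A B : Fin n ⊕ Fin m → ℝ} {z : XVec n m}
    (hz : z ∈ interior (rect (box (A ∘ Sum.inl) (B ∘ Sum.inl)) (box (A ∘ Sum.inr) (B ∘ Sum.inr))))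
    (k : Fin n ⊕ Fin m) : A k < z k ∧ z k < B k := by
  have hopen : IsOpenMap (EuclideanSpace.proj k : XVec n m →L[ℝ] ℝ) :=
    ContinuousLinearMap.isOpenMap _ fun t => ⟨EuclideanSpace.single k t, by simp⟩
  have h1 : (EuclideanSpace.proj k : XVec n m →L[ℝ] ℝ) '' interior
      (rect (box (A ∘ Sum.inl) (B ∘ Sum.inl)) (box (A ∘ Sum.inr) (B ∘ Sum.inr)))
      ⊆ interior (Icc (A k) (B k)) := by
    refine interior_maximal ?_ (hopen _ isOpen_interior)
    rintro _ ⟨y, hy, rfl⟩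
    exact mem_rect_box.1 (interior_subset hy) k
  have h2 := h1 ⟨z, hz, rfl⟩
  rwa [interior_Icc] at h2

/-! ### Accurate models and gains -/

/-- The rank-one operator `⟨x, ·⟩ y / ‖x‖²` does it. It turns a relative pointwise error into an
uncertainty matrix `[ΔA_0, ΔB_0]`. -/
lemma exists_clm_apply_eq {E F : Type*} [NormedAddCommGroup E] [InnerProductSpace ℝ E]
    [NormedAddCommGroup F] [NormedSpace ℝ F] {x : E} {y : F} {ε : ℝ} (hε : 0 ≤ ε)
    (h : ‖y‖ ≤ ε * ‖x‖) : ∃ Δ : E →L[ℝ] F, ‖Δ‖ ≤ ε ∧ Δ x = y := by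
  by_cases hx : x = 0
  · refine ⟨0, by simpa using hε, ?_⟩
    rw [hx, norm_zero, mul_zero] at h
    rw [norm_le_zero_iff.1 h]
    rfl
  have hx' : 0 < ‖x‖ := norm_pos_iff.2 hx
  refine ⟨(innerSL ℝ x).smulRight ((‖x‖ ^ 2)⁻¹ • y), ?_, ?_⟩
  · rw [ContinuousLinearMap.norm_smulRight_apply, innerSL_apply_norm, norm_smul, norm_inv,
      Real.norm_of_nonneg (by positivity)]
    calc _ ≤ ‖x‖ * ((‖x‖ ^ 2)⁻¹ * (ε * ‖x‖)) := by gcongr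
      _ = ε := by field_simp
  · rw [ContinuousLinearMap.smulRight_apply, innerSL_apply_apply, real_inner_self_eq_norm_sq,
      smul_smul, mul_inv_cancel₀ (by positivity), one_smul]

/-- The columns of a matrix that act on the state. -/
def stBlock {V : Type*} [NormedAddCommGroup V] [NormedSpace ℝ V] (D : XVec n m →L[ℝ] V) :
    Vec n →L[ℝ] V :=
  (D.comp joinL).comp (ContinuousLinearMap.inl ℝ (Vec n) (Vec m))

/-- The columns of a matrix that act on the input. -/
def inpBlock {V : Type*} [NormedAddCommGroup V] [NormedSpace ℝ V] (D : XVec n m →L[ℝ] V) :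
    Vec m →L[ℝ] V :=
  (D.comp joinL).comp (ContinuousLinearMap.inr ℝ (Vec n) (Vec m))

lemma stBlock_add_inpBlock {V : Type*} [NormedAddCommGroup V] [NormedSpace ℝ V]
    (D : XVec n m →L[ℝ] V) (z : XVec n m) : stBlock D (st z) + inpBlock D (inp z) = D z := by
  have h : (D.comp joinL) (st z, inp z) = D z := by
    simp only [ContinuousLinearMap.comp_apply, joinL_apply, joinVec_st_inp]
  rw [← h]
  simp only [stBlock, inpBlock, ContinuousLinearMap.comp_apply]
  rw [← map_add, ← map_add]
  simp

lemma exists_norm_sub_fderiv_le {V : Type*} [NormedAddCommGroup V] [NormedSpace ℝ V]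
    {φ : XVec n m → V} (hφ : DifferentiableAt ℝ φ 0) (hφ0 : φ 0 = 0) {ε : ℝ} (hε : 0 < ε) :
    ∃ δ > 0, ∀ x, ‖x‖ < δ → ‖φ x - fderiv ℝ φ 0 x‖ ≤ ε * ‖x‖ := by
  have h := hφ.hasFDerivAt.isLittleO.def hε
  obtain ⟨δ, hδ, hx⟩ := Metric.eventually_nhds_iff.1 h
  refine ⟨δ, hδ, fun x h1 => ?_⟩
  have := hx (y := x) (by simpa using h1)
  simpa [hφ0] using this

/-- Only `x` is confined to the ball: in the application `y` is the centre of a grid cell, which may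
lie outside the region. -/
lemma exists_norm_sub_le_of_isCompact {V : Type*} [NormedAddCommGroup V] {φ : XVec n m → V}
    (hφ : Continuous φ) (R : ℝ) {ε : ℝ} (hε : 0 < ε) :
    ∃ δ > 0, ∀ x y, ‖x‖ ≤ R → ‖x - y‖ < δ → ‖φ x - φ y‖ ≤ ε := by
  have h := (isCompact_closedBall (0 : XVec n m) R).uniformContinuousAt_of_continuousAt φ
    (fun _ _ => hφ.continuousAt) (Metric.dist_mem_uniformity hε)
  obtain ⟨δ, hδ, h1⟩ := Metric.mem_uniformity_dist.1 h
  refine ⟨δ, hδ, fun x y hx hxy => ?_⟩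
  have := h1 (a := x) (b := y) (by rwa [dist_eq_norm]) (mem_closedBall_zero_iff.2 hx)
  rw [← dist_eq_norm]
  exact le_of_lt this

/-- On a bounded region there are arbitrarily accurate uncertain piecewise affine models, with gains
for which the sliding motion is arbitrarily close to the stabilized system, relatively to the size
of the extended state. -/
theorem exists_model {f : XVec n m → Vec n} {g : XVec n m → Vec m} (hf : Continuous f)
    (hg : Continuous g) (hf0 : f 0 = 0) (hg0 : g 0 = 0) (hfd : DifferentiableAt ℝ f 0)
    (hgd : DifferentiableAt ℝ g 0) (X : Set (Vec n)) (U : Set (Vec m)) {R : ℝ}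
    (hR : ∀ x ∈ rect X U, ‖x‖ ≤ R) (Sx : Vec n →L[ℝ] Vec m) (Su : Vec m ≃L[ℝ] Vec m) {ε η : ℝ}
    (hε : 0 < ε) (hη : 0 < η) :
    ∃ (l : ℕ) (p : PWAModel f X U l) (c : Gains n m l), (p.εf0 ≤ ε ∧ p.εf ≤ ε ∧ p.εg ≤ ε) ∧
      ∀ i, ∀ x ∈ p.cell i, ‖c.law i x - Su.symm (mismatch p Sx i x) - g x‖ ≤ η * ‖x‖ := by
  set K : Vec n →L[ℝ] Vec m := (Su.symm : Vec m →L[ℝ] Vec m).comp Sx with hK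
  have hs : 0 < ‖K‖ + 1 := by positivity
  -- Half of `η` is reserved for the error of `f`, which acts through `K = S_u⁻¹ S_x`, and half for
  -- the error of `g`.
  set ε₁ := min ε (η / (2 * (‖K‖ + 1))) with hε₁
  have hε₁0 : 0 < ε₁ := by positivity
  obtain ⟨δf, hδf, hfδ⟩ := exists_norm_sub_fderiv_le hfd hf0 hε₁0
  obtain ⟨δg, hδg, hgδ⟩ := exists_norm_sub_fderiv_le hgd hg0 (half_pos hη)
  set ν : ℝ := ((Fintype.card (Fin n ⊕ Fin m) : ℕ) : ℝ) with hν
  have hν0 : 0 ≤ ν := Nat.cast_nonneg _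
  have hsmall : ∀ {δ : ℝ}, 0 < δ → ν * (δ / (ν + 1)) < δ := fun {δ} hδ => by
    rw [← mul_div_assoc, div_lt_iff₀ (by positivity)]
    nlinarith
  -- A vector with components at most `r` has norm at most `ν * r`, which is below both
  -- linearization radii.
  set r := min δf δg / (ν + 1) with hr
  have hr0 : 0 < r := by positivity
  -- Outside the central cube `‖x‖ ≥ r`, so an absolute error `η * r / 2` is at most `η / 2 * ‖x‖`.
  set ε₂ := min ε (η * r / (2 * (‖K‖ + 1))) with hε₂
  have hε₂0 : 0 < ε₂ := by positivity
  obtain ⟨δf', hδf', hfu⟩ := exists_norm_sub_le_of_isCompact hf R hε₂0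
  obtain ⟨δg', hδg', hgu⟩ := exists_norm_sub_le_of_isCompact hg R (by positivity : 0 < η * r / 2)
  set δ := min δf' δg' / (ν + 1) with hδ
  have hδ0 : 0 < δ := by positivity
  obtain ⟨l, A, B, ctr, hAB, hcov, hdis, hzero, hout⟩ :=
    exists_grid (Fin n ⊕ Fin m) (R := R) hr0 hδ0
  set y : Fin (l + 1) → XVec n m := fun i => WithLp.toLp 2 (ctr i) with hy
  have hinner : ∀ x : XVec n m, (∀ k, A 0 k ≤ x k ∧ x k ≤ B 0 k) →
      ‖f x - fderiv ℝ f 0 x‖ ≤ ε₁ * ‖x‖ ∧ ‖g x - fderiv ℝ g 0 x‖ ≤ η / 2 * ‖x‖ := by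
    intro x hx
    have h1 : ‖x‖ < min δf δg := by
      refine (norm_le_card_mul (δ := r) fun k => ?_).trans_lt (hsmall (by positivity))
      have := hx k
      rw [(hzero k).1, (hzero k).2] at this
      exact abs_le.2 this
    exact ⟨hfδ x (h1.trans_le (min_le_left _ _)), hgδ x (h1.trans_le (min_le_right _ _))⟩
  have houter : ∀ i, i ≠ 0 → ∀ x ∈ rect X U, (∀ k, A i k ≤ x k ∧ x k ≤ B i k) →
      r ≤ ‖x‖ ∧ ‖f x - f (y i)‖ ≤ ε₂ ∧ ‖g x - g (y i)‖ ≤ η * r / 2 := by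
    intro i hi x hxXU hx
    obtain ⟨⟨k, hk⟩, hc⟩ := hout i hi x hx
    have h1 : ‖x - y i‖ < min δf' δg' :=
      (norm_le_card_mul (δ := δ) hc).trans_lt (hsmall (by positivity))
    refine ⟨hk.trans ?_, hfu x _ (hR x hxXU) (h1.trans_le (min_le_left _ _)),
      hgu x _ (hR x hxXU) (h1.trans_le (min_le_right _ _))⟩
    rw [← Real.norm_eq_abs]
    exact PiLp.norm_apply_le x k
  -- The model is the linearization in the cell `0` and the constant value at the centre in every
  -- other cell, where the whole error goes into `ΔC` and `εf` can be zero.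
  let p : PWAModel f X U l :=
    { P := fun i => box (A i ∘ Sum.inl) (B i ∘ Sum.inl)
      Q := fun i => box (A i ∘ Sum.inr) (B i ∘ Sum.inr)
      polyhedron_P := fun i => ⟨isPolyhedron_box _ _, interior_box_nonempty fun k => hAB i _⟩
      polyhedron_Q := fun i => ⟨isPolyhedron_box _ _, interior_box_nonempty fun k => hAB i _⟩
      cover := fun x hx => by
        obtain ⟨i, hi⟩ := hcov x fun k => by
          rw [← Real.norm_eq_abs]
          exact (PiLp.norm_apply_le x k).trans (hR x hx)
        exact mem_iUnion.2 ⟨i, mem_rect_box.2 hi⟩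
      adjacent := fun i j hij => by
        refine disjoint_left.2 fun x hxi hxj => ?_
        obtain ⟨k, hk⟩ := hdis i j hij
        have h1 := lt_of_mem_interior_rect_box hxi k
        have h2 := lt_of_mem_interior_rect_box hxj k
        rcases hk with hk | hk <;> linarith [h1.1, h1.2, h2.1, h2.2]
      origin := fun i => by
        rw [mem_rect_box]
        refine ⟨fun h => ?_, ?_⟩
        · by_contra hi
          obtain ⟨⟨k, hk⟩, -⟩ := hout i hi _ h
          simp only [PiLp.zero_apply, abs_zero] at hk
          linarith
        · rintro rfl k
          rw [(hzero k).1, (hzero k).2]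
          simp only [PiLp.zero_apply]
          constructor <;> linarith
      A := fun i => if i = 0 then stBlock (fderiv ℝ f 0) else 0
      B := fun i => if i = 0 then inpBlock (fderiv ℝ f 0) else 0
      C := fun i => if i = 0 then 0 else f (y i)
      C_zero := if_pos rfl
      εf0 := ε₁
      εf := 0
      εg := ε₂
      approx_zero := fun z hz => by
        obtain ⟨Δ, hΔ, hΔz⟩ := exists_clm_apply_eq hε₁0.le
          (hinner z (mem_rect_box.1 ⟨hz.1.2, hz.2.2⟩)).1
        refine ⟨Δ, hΔ, ?_⟩
        simp only [if_true]
        rw [hΔz, stBlock_add_inpBlock]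
        abel
      approx := fun j hj z hz => by
        refine ⟨0, f z - f (y j), by simp, (houter j hj z ⟨hz.1.1, hz.2.1⟩
          (mem_rect_box.1 ⟨hz.1.2, hz.2.2⟩)).2.1, ?_⟩
        simp [if_neg hj]
      εf0_nonneg := hε₁0.le
      εf_nonneg := le_rfl
      εg_nonneg := hε₂0.le }
  let c : Gains n m l :=
    { F := fun i => if i = 0 then stBlock (fderiv ℝ g 0) else 0
      G := fun i => if i = 0 then inpBlock (fderiv ℝ g 0) else 0
      D := fun i => if i = 0 then 0 else g (y i)
      D_zero := if_pos rfl }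
  refine ⟨l, p, c, ⟨min_le_left _ _, hε.le, min_le_left _ _⟩, fun i x hx => ?_⟩
  have hxb := mem_rect_box.1 (⟨hx.1.2, hx.2.2⟩ : x ∈ rect (p.P i) (p.Q i))
  have hxXU : x ∈ rect X U := ⟨hx.1.1, hx.2.1⟩
  have hKm : Su.symm (mismatch p Sx i x) = K (f x - p.nominal i x) := rfl
  have hKle : ∀ {e : Vec n} {b : ℝ}, ‖e‖ ≤ b / (2 * (‖K‖ + 1)) → 0 ≤ b → ‖K e‖ ≤ b / 2 := by
    intro e b he hb
    calc ‖K e‖ ≤ ‖K‖ * ‖e‖ := K.le_opNorm e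
      _ ≤ (‖K‖ + 1) * (b / (2 * (‖K‖ + 1))) := by gcongr; linarith
      _ = b / 2 := by field_simp
  have htri : ∀ a b d : Vec m, ‖a - b - d‖ ≤ ‖d - a‖ + ‖b‖ := fun a b d => by
    rw [norm_sub_rev d a, sub_right_comm]
    exact norm_sub_le _ _
  rw [hKm]
  refine (htri _ _ _).trans ?_
  by_cases hi : i = 0
  · subst hi
    obtain ⟨h1, h2⟩ := hinner x hxb
    have e1 : c.law 0 x = fderiv ℝ g 0 x := by
      simp only [Gains.law, c, if_true, add_zero]
      exact stBlock_add_inpBlock _ x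
    have e2 : p.nominal 0 x = fderiv ℝ f 0 x := by
      simp only [PWAModel.nominal, p, if_true, add_zero]
      exact stBlock_add_inpBlock _ x
    rw [e1, e2]
    have h3 : ‖f x - fderiv ℝ f 0 x‖ ≤ η * ‖x‖ / (2 * (‖K‖ + 1)) := by
      refine h1.trans ((mul_le_mul_of_nonneg_right (min_le_right _ _) (norm_nonneg x)).trans ?_)
      rw [div_mul_eq_mul_div]
    have := hKle h3 (by positivity)
    linarith
  · obtain ⟨h0, h1, h2⟩ := houter i hi x hxXU hxb
    have e1 : c.law i x = g (y i) := by simp [Gains.law, c, if_neg hi]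
    have e2 : p.nominal i x = f (y i) := by simp [PWAModel.nominal, p, if_neg hi]
    rw [e1, e2]
    have h3 := hKle (h1.trans (min_le_right _ _)) (by positivity)
    have := mul_le_mul_of_nonneg_left h0 hη.le
    linarith

end

end ISMPC

namespace ISMPC

/-! ### Consequences of global exponential stability -/

variable {n m : ℕ} {F : XVec n m → XVec n m}

/-- The estimate forces the solution from the origin to stay there, and its one-sided derivative at
time zero is both `F 0` and `0`. -/
lemma IsGloballyExpStable.apply_zero (h : IsGloballyExpStable F) : F 0 = 0 := by
  obtain ⟨hex, k, -, a, -, hexp⟩ := h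
  obtain ⟨z, hz0, hz⟩ := hex 0
  have h1 : ∀ t, 0 ≤ t → z t = 0 := fun t ht => by
    have := hexp z hz t ht
    rw [hz0, norm_zero, mul_zero] at this
    exact norm_le_zero_iff.1 this
  have h2 := hz 0 le_rfl
  rw [hz0] at h2
  have h3 : HasDerivWithinAt z 0 (Ici 0) 0 :=
    (hasDerivWithinAt_const (0 : ℝ) (Ici 0) (0 : XVec n m)).congr (fun t ht => h1 t ht) hz0
  exact (uniqueDiffWithinAt_Ici (0 : ℝ)).eq_deriv _ h2 h3

lemma locallyLipschitz_closedLoopField {f : XVec n m → Vec n} {g : XVec n m → Vec m}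
    (hf : LocallyLipschitz f) (hg : LocallyLipschitz g) :
    LocallyLipschitz (closedLoopField f g) := by
  have h : closedLoopField f g = (joinL (n := n) (m := m)) ∘ fun z => (f z, g z) := rfl
  rw [h]
  exact (ContinuousLinearMap.lipschitz joinL).locallyLipschitz.comp (hf.prodMk hg)

end ISMPC

end

/-! ### The main theorem: choice of constants and assembly. -/

theorem theorem3p3 (n m : ℕ) (f : ISMPC.XVec n m → ISMPC.Vec n) (hf : ContDiff ℝ 1 f)
    (hGES : ISMPC.IsGES f) :
    ∃ M > 0, ∃ α > 0, ∀ (X : Set (ISMPC.Vec n)) (U : Set (ISMPC.Vec m)),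
      IsCompact X → IsCompact U → 0 ∈ X → 0 ∈ U →
      ∀ (Sx : ISMPC.Vec n →L[ℝ] ISMPC.Vec m) (Su : ISMPC.Vec m ≃L[ℝ] ISMPC.Vec m) (γ ε : ℝ),
        0 < γ → 0 < ε →
        ∃ (l : ℕ) (p : ISMPC.PWAModel f X U l) (c : ISMPC.Gains n m l),
          (p.εf0 ≤ ε ∧ p.εf ≤ ε ∧ p.εg ≤ ε) ∧
          -- the sliding surface is kept from the initial time on
          (∀ T z w v, 0 ≤ T → ISMPC.IsClosedLoopSolution p c Sx Su γ T z w v →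
            (∀ t ∈ Set.Icc 0 T, ISMPC.slidingVar p c Sx Su z w t = 0) ∧
              ISMPC.IsSlidingMotion p c Sx Su T z w) ∧
          -- exponential decay of the sliding motion
          (∀ T z w, 0 ≤ T → ISMPC.IsSlidingMotion p c Sx Su T z w →
            ∀ t ∈ Set.Icc 0 T, ‖z t‖ ≤ M * Real.exp (-α * t) * ‖z 0‖) ∧
          -- closed-loop trajectories exist, and continue for all times inside the region
          (∀ z₀ : ISMPC.XVec n m, Metric.closedBall 0 (M * ‖z₀‖) ⊆ ISMPC.rect X U →
            (∃ z w v, z 0 = z₀ ∧ ∀ T, 0 ≤ T → ISMPC.IsClosedLoopSolution p c Sx Su γ T z w v) ∧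
            ∀ T z w v, 0 ≤ T → z 0 = z₀ → ISMPC.IsClosedLoopSolution p c Sx Su γ T z w v →
              ∃ z' w' v', Set.EqOn z' z (Set.Icc 0 T) ∧
                ∀ T', 0 ≤ T' → ISMPC.IsClosedLoopSolution p c Sx Su γ T' z' w' v') := by
  obtain ⟨g, hgL, hgd, hGES⟩ := hGES
  have hF0 := hGES.apply_zero
  obtain ⟨hex, k₀, hk₀, a, ha, hexp₀⟩ := hGES
  have hfc : Continuous f := hf.continuous
  have hgc : Continuous g := hgL.continuous
  have hf0 : f 0 = 0 := congrArg ISMPC.st hF0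
  have hg0 : g 0 = 0 := congrArg ISMPC.inp hF0
  have hFL := ISMPC.locallyLipschitz_closedLoopField hf.locallyLipschitz hgL
  set k := max k₀ 1 with hk
  have hk1 : 1 ≤ k := le_max_right _ _
  have hk0 : 0 < k := one_pos.trans_le hk1
  have hexp : ∀ y : ℝ → ISMPC.XVec n m,
      (∀ t, 0 ≤ t → HasDerivWithinAt y (ISMPC.closedLoopField f g (y t)) (Set.Ici 0) t) →
      ∀ t, 0 ≤ t → ‖y t‖ ≤ k * Real.exp (-a * t) * ‖y 0‖ := fun y hy t ht => by
    refine (hexp₀ y hy t ht).trans ?_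
    gcongr
    exact le_max_left _ _
  obtain ⟨T₀, hT₀, hkT⟩ : ∃ T₀ > 0, k * Real.exp (-a * T₀) ≤ 1 / 4 := by
    refine ⟨Real.log (4 * k) / a, div_pos (Real.log_pos (by linarith)) ha, ?_⟩
    rw [neg_mul, mul_div_cancel₀ _ ha.ne', Real.exp_neg, Real.exp_log (by positivity)]
    field_simp
    norm_num
  have hα : 0 < Real.log 2 / T₀ := div_pos (Real.log_pos one_lt_two) hT₀
  -- The decay constant is `2 * (k + 1)`; doubling it leaves the strict gap that the continuation
  -- argument needs. Both constants are fixed before the region is given.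
  refine ⟨4 * (k + 1), by positivity, Real.log 2 / T₀, hα, ?_⟩
  intro X U hX hU hX0 hU0 Sx Su γ ε hγ hε
  obtain ⟨R, hR⟩ : ∃ R, ∀ x ∈ ISMPC.rect X U, ‖x‖ ≤ R := by
    obtain ⟨R₁, h1⟩ := hX.isBounded.exists_norm_le
    obtain ⟨R₂, h2⟩ := hU.isBounded.exists_norm_le
    refine ⟨R₁ + R₂, fun x hx => ?_⟩
    rw [← ISMPC.joinVec_st_inp x]
    exact (ISMPC.norm_joinVec_le _ _).trans (add_le_add (h1 _ hx.1) (h2 _ hx.2))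
  obtain ⟨L, hL⟩ := LocallyLipschitzOn.exists_lipschitzOnWith_of_compact
    (isCompact_closedBall (0 : ISMPC.XVec n m) (k * R)) hFL.locallyLipschitzOn
  -- The size of the region enters here, through the Lipschitz constant `L` on the ball of radius `k
  -- * R`; it affects only the required accuracy of the model.
  obtain ⟨η, hη0, hη1, hηk⟩ : ∃ η : ℝ, 0 < η ∧ η ≤ 1 ∧
      η * k * Real.exp ((L + 1) * T₀) ≤ 1 / 4 := by
    refine ⟨min 1 (1 / 4 / (k * Real.exp ((L + 1) * T₀))), by positivity, min_le_left _ _, ?_⟩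
    rw [mul_assoc, ← le_div_iff₀ (by positivity)]
    exact min_le_right _ _
  obtain ⟨l, p, c, hpε, happrox⟩ := ISMPC.exists_model hfc hgc hf0 hg0
    (hf.differentiable one_ne_zero 0) hgd X U hR Sx Su hε hη0
  have hdecay : ∀ T z w, 0 ≤ T → ISMPC.IsSlidingMotion p c Sx Su T z w → ∀ t ∈ Set.Icc 0 T,
      ‖z t‖ ≤ 2 * (k + 1) * Real.exp (-(Real.log 2 / T₀) * t) * ‖z 0‖ := fun T z w _ h t ht =>
    (h.isPerturbedSolution hfc hgc hR happrox).norm_le_exp hFL.continuous hex ha hk1 hexp hL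
      hη0.le hη1 hηk hT₀ hkT ht
  have hbound : ∀ T z w, 0 ≤ T → ISMPC.IsSlidingMotion p c Sx Su T z w → ∀ t ∈ Set.Icc 0 T,
      ‖z t‖ ≤ 2 * (k + 1) * ‖z 0‖ := fun T z w hT h t ht => by
    refine (hdecay T z w hT h t ht).trans ?_
    have : Real.exp (-(Real.log 2 / T₀) * t) ≤ 1 := Real.exp_le_one_iff.2 (by nlinarith [ht.1])
    have := mul_le_mul_of_nonneg_left this (by positivity : 0 ≤ 2 * (k + 1))
    rw [mul_one] at this
    gcongr
  have hextend : ∀ T z w, 0 ≤ T → ISMPC.IsSlidingMotion p c Sx Su T z w →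
      Metric.closedBall 0 (4 * (k + 1) * ‖z 0‖) ⊆ ISMPC.rect X U →
      ∃ z' w' v', Set.EqOn z' z (Set.Icc 0 T) ∧
        ∀ T', 0 ≤ T' → ISMPC.IsClosedLoopSolution p c Sx Su γ T' z' w' v' := by
    intro T z w hT h hball
    obtain ⟨z', w', heq, h'⟩ := h.exists_extension hfc hf0 hX.isClosed hU.isClosed
      (by positivity : 0 ≤ 2 * (k + 1)) (by linarith) hbound hT hball
    obtain ⟨v', hv'⟩ := ISMPC.exists_isClosedLoopSolution hfc hγ h'
    exact ⟨z', w', v', heq, hv'⟩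
  refine ⟨l, p, c, hpε, fun T z w v _ h => ⟨h.slidingVar_eq_zero hfc hγ.le,
    h.isSlidingMotion hfc hγ.le⟩, fun T z w hT h t ht => ?_, fun z₀ hball => ⟨?_, ?_⟩⟩
  · refine (hdecay T z w hT h t ht).trans ?_
    gcongr
    norm_num
  · have hz₀ : z₀ ∈ ISMPC.rect X U := hball (mem_closedBall_zero_iff.2
      (by nlinarith [norm_nonneg z₀]))
    -- Existence is the extension of a motion of duration zero. The weights may be zero because
    -- their conditions hold almost everywhere on `[0, 0]`, a null set.
    have h0 : ISMPC.IsSlidingMotion p c Sx Su 0 (fun _ => z₀) (fun _ _ => 0) := by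
      have hae : ∀ {P : ℝ → Prop}, ∀ᵐ t ∂MeasureTheory.volume.restrict (Set.Icc (0 : ℝ) 0), P t :=
        fun {P} => by simp
      refine ⟨continuousOn_const, fun _ _ => hz₀, ⟨fun _ => measurable_const, hae, hae, hae⟩,
        fun t ht => ?_, fun t ht => ?_⟩
      all_goals
        rw [le_antisymm ht.2 ht.1]
        simp
    obtain ⟨z, w, v, heq, h⟩ := hextend 0 _ _ le_rfl h0 hball
    exact ⟨z, w, v, heq (Set.left_mem_Icc.2 le_rfl), h⟩
  · rintro T z w v hT rfl h
    exact hextend T z w hT (h.isSlidingMotion hfc hγ.le) hball
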